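/- Let $d,k\in\mathbb N$ with $2k>d$, let $\hbar,m,\beta,\nu>0$, and let $V:\mathbb R^d\to\mathbb R$ belong to the Sobolev space $H^{\max(2,k)}(\mathbb R^d)$. Fix representatives $\partial_{r}\partial_{s}V\in L^2(\mathbb R^d)$ of the weak second derivatives of $V$, put $\Delta V=\sum_r\partial_r\partial_rV$, and fix a point $x\in\mathbb R^d$. Let $X_k^v=L^2(\mathbb R^d,(1+|v|^{2k})\,dv;\mathbb R)$, let $(\mathcal F f)(\eta)=(2\pi)^{-d/2}\int f(v)e^{-iv\cdot\eta}\,dv$ with inverse $(\mathcal F^{-1}g)(v)=(2\pi)^{-d/2}\int g(\eta)e^{iv\cdot\eta}\,d\eta$, and set $$\delta V(x,\eta)=\tfrac1\hbar\Big[V\big(x+\tfrac{\hbar\eta}{2m}\big)-V\big(x-\tfrac{\hbar\eta}{2m}\big)\Big],\qquad F(v)=\Big(\frac{\beta m}{2\pi}\Big)^{d/2}e^{-\beta m|v|^2/2}.$$ For $w\in X_k^v$ define $$\mathcal A w=\mathcal F^{-1}\big(i\,\delta V(x,\cdot)\,\mathcal F w\big),\qquad \mathcal C w=-(\nu w-\Omega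 w),$$ $$(\Omega w)(v)=\nu F(v)\Big\{1+\hbar^2\frac{\beta^2}{24}\Big[-\frac1m\Delta V(x)+\beta\sum_{r,s=1}^d v_rv_s\,\partial_r\partial_sV(x)\Big]\Big\}\int_{\mathbb R^d} w(v')\,dv'.$$ Then $\mathcal A+\mathcal C$ is a well-defined linear operator from $X_k^v$ to itself; the function $$M(x,v)=\nu\,\mathcal F^{-1}\Big\{\frac{\mathcal F F(\eta)}{\nu-i\,\delta V(x,\eta)}\Big(1-\frac{\beta\hbar^2}{24m^2}\sum_{r,s=1}^d\eta_r\eta_s\,\partial_r\partial_sV(x)\Big)\Big\}(v)$$ is real-valued (for almost every $v$) and $M(x,\cdot)\in X_k^v$; the kernel of $\mathcal A+\mathcal C$ in $X_k^v$ is the one-dimensional space $$\ker(\mathcal A+\mathcal C)=\{c\,M(x,\cdot):c\in\mathbb R\};$$ and, for every $h\in X_k^v$, the equation $(\mathcal A+\mathcal C)w=h$ has a solution $w\in X_k^v$ if and only if $$\int_{\mathbb R^d}h(v)\,dv=0.$$ -/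

import Mathlib

open MeasureTheory

noncomputable section

namespace WignerBGK

open TemperedDistribution LineDeriv

/-- The space `ℝ^d` with its Euclidean norm, used for `x`, `v` and `η`. -/
abbrev Space (d : ℕ) : Type := EuclideanSpace ℝ (Fin d)

/-- The weighted Lebesgue measure `(1 + |v|^{2k}) dv` on `ℝ^d`. -/
def weightedMeasure (d k : ℕ) : Measure (Space d) :=
  (volume : Measure (Space d)).withDensity (fun v => ENNReal.ofReal (1 + ‖v‖ ^ (2 * k)))

/-- The real Hilbert space `X_k^v = L²(ℝ^d, (1 + |v|^{2k}) dv; ℝ)`. -/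
abbrev Xkv (d k : ℕ) : Type := Lp ℝ 2 (weightedMeasure d k)

/-- `V ∈ H^s(ℝ^d; ℝ)`: the function `V` is in `L²`, and the tempered distribution that it defines
belongs to the Sobolev space of order `s` with exponent `2`. -/
def MemH {d : ℕ} (s : ℕ) (V : Space d → ℝ) : Prop :=
  ∃ hV : MemLp (fun x => (V x : ℂ)) 2 (volume : Measure (Space d)),
    MemSobolev (s : ℝ) 2 (Lp.toTemperedDistribution hV.toLp)

/-- `H r s` is a (pointwise defined) representative of the weak derivative `∂²V/∂x_r∂x_s ∈ L²`,
for all `r` and `s`. -/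
def IsWeakHessian {d : ℕ} (V : Space d → ℝ) (H : Fin d → Fin d → Space d → ℝ) : Prop :=
  ∃ hV : MemLp (fun x => (V x : ℂ)) 2 (volume : Measure (Space d)),
    ∀ r s : Fin d, ∃ hH : MemLp (fun x => (H r s x : ℂ)) 2 (volume : Measure (Space d)),
      ∂_{(EuclideanSpace.single r (1 : ℝ) : Space d)}
        (∂_{(EuclideanSpace.single s (1 : ℝ) : Space d)}
          (Lp.toTemperedDistribution hV.toLp)) = Lp.toTemperedDistribution hH.toLp

/-- The Fourier transform `(𝓕 f)(η) = (2π)^{-d/2} ∫ f(v) e^{-i v·η} dv`. -/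
def fourierV {d : ℕ} (f : Space d → ℂ) (η : Space d) : ℂ :=
  (((2 * Real.pi) ^ (-(d : ℝ) / 2) : ℝ) : ℂ) *
    ∫ v : Space d, f v * Complex.exp (-(Complex.I * ((inner ℝ v η : ℝ) : ℂ)))

/-- The inverse Fourier transform `(𝓕⁻¹ g)(v) = (2π)^{-d/2} ∫ g(η) e^{i v·η} dη`. -/
def fourierVInv {d : ℕ} (g : Space d → ℂ) (v : Space d) : ℂ :=
  (((2 * Real.pi) ^ (-(d : ℝ) / 2) : ℝ) : ℂ) *
    ∫ η : Space d, g η * Complex.exp (Complex.I * ((inner ℝ v η : ℝ) : ℂ))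

/-- `δV(x,η) = ħ⁻¹ [V(x + ħη/(2m)) - V(x - ħη/(2m))]`. -/
def deltaV {d : ℕ} (hbar m : ℝ) (V : Space d → ℝ) (x η : Space d) : ℝ :=
  (1 / hbar) * (V (x + (hbar / (2 * m)) • η) - V (x - (hbar / (2 * m)) • η))

/-- The pseudo-differential operator at the point `x`:
`(Θ[V]w)(v) = i (2π)^{-d/2} ∫ δV(x,η) (𝓕 w)(η) e^{i v·η} dη`. -/
def Theta {d : ℕ} (hbar m : ℝ) (V : Space d → ℝ) (x : Space d) (w : Space d → ℝ) :
    Space d → ℂ :=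
  fourierVInv (fun η => Complex.I * (deltaV hbar m V x η : ℂ) * fourierV (fun v => (w v : ℂ)) η)

/-- The normalized Maxwellian `F(v) = (βm/(2π))^{d/2} e^{-βm|v|²/2}`. -/
def maxwellian {d : ℕ} (m β : ℝ) (v : Space d) : ℝ :=
  (β * m / (2 * Real.pi)) ^ ((d : ℝ) / 2) * Real.exp (-(β * m * ‖v‖ ^ 2 / 2))

/-- The operator `Ω` at the point `x`, where `H` stands for the Hessian of `V`:
`(Ωw)(v) = ν F(v) {1 + ħ² (β²/24) [-ΔV(x)/m + β ∑ v_r v_s ∂²V/∂x_r∂x_s(x)]} ∫ w(v') dv'`. -/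
def Omega {d : ℕ} (hbar m β ν : ℝ) (H : Fin d → Fin d → Space d → ℝ) (x : Space d)
    (w : Space d → ℝ) (v : Space d) : ℝ :=
  ν * maxwellian m β v *
    (1 + hbar ^ 2 * (β ^ 2 / 24) *
      (-(1 / m) * ∑ r, H r r x + β * ∑ r, ∑ s, v r * v s * H r s x)) *
    ∫ v' : Space d, w v'

/-- The function `(𝒜 + 𝒞)w = Θ[V]w - (ν w - Ωw)` at the point `x`. -/
def opAC {d : ℕ} (hbar m β ν : ℝ) (V : Space d → ℝ) (H : Fin d → Fin d → Space d → ℝ)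
    (x : Space d) (w : Space d → ℝ) (v : Space d) : ℂ :=
  Theta hbar m V x w v + -((ν : ℂ) * (w v : ℂ) - (Omega hbar m β ν H x w v : ℂ))

/-- The function
`M(x,v) = ν 𝓕⁻¹{ 𝓕F(η)/(ν - i δV(x,η)) (1 - βħ²/(24m²) ∑ η_r η_s ∂²V/∂x_r∂x_s(x)) }(v)`. -/
def kernelM {d : ℕ} (hbar m β ν : ℝ) (V : Space d → ℝ) (H : Fin d → Fin d → Space d → ℝ)
    (x : Space d) (v : Space d) : ℂ :=
  (ν : ℂ) * fourierVInv (fun η =>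
    fourierV (fun u => (maxwellian m β u : ℂ)) η /
      ((ν : ℂ) - Complex.I * (deltaV hbar m V x η : ℂ)) *
    (1 - ((β * hbar ^ 2 / (24 * m ^ 2) * ∑ r, ∑ s, η r * η s * H r s x : ℝ) : ℂ))) v

end WignerBGK

end

open MeasureTheory

noncomputable section

namespace WignerBGK

open Convolution ContinuousLinearMap Filter Topology
open scoped ENNReal FourierTransform SchwartzMap ContDiff

/-! ### Convolution estimates -/

section Convolution

variable {E : Type*} [NormedAddCommGroup E] [InnerProductSpace ℝ E] [FiniteDimensional ℝ E]
  [MeasurableSpace E] [BorelSpace E]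

/-! The potential operator is a convolution. Since `V` lies in `H^k`, its Fourier transform is
square integrable against `1 + |ξ|^{2k}`, hence integrable because `2k > d`. A translation, an
antisymmetrisation and a dilation turn it into a real odd kernel `K` in `X_k^v` whose Fourier
integral is `i δV(x,·)` (`MemH.exists_kernel`). By the convolution theorem and Fourier inversion, `𝒜
w = K ⋆ w` (`Theta_ae_eq_conv`).

Write `Q` for the local equilibrium, of integral 1, and `S w = ν w - K ⋆ w`. Then `(𝒜 + 𝒞) w = ν (∫
w) Q - S w`, and everything follows once `S` is bijective on `X_k^v` (`bijective_sub_convOp`).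
Convolution with an odd kernel is skew-symmetric on `L²`, so only its commutator with the weight
`|v|^k` obstructs coercivity. The inequality `| |v|^k - |v-t|^k | ≤ ε |v-t|^k + C |t|^k` bounds this
commutator by a small multiple of the weighted norm plus a multiple of `‖w‖_{L¹}`. The `L¹` norm is
in turn small relative to `(L ‖w‖² + ‖|v|^k w‖²)^{1/2}` when `L` is large. Thus `S` is coercive for
an equivalent inner product, for every `ν > 0`, and Lax–Milgram applies.

As `K` has integral zero, `∫ S w = ν ∫ w`. Linear algebra for a rank-one perturbation
(`ker_range_rankOne_sub`) then gives the kernel, spanned by `M = ν S⁻¹ Q`, and the range, the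
functions of integral zero. The Fourier transform of `S M = ν Q`, with that of `Q` computed from
Gaussian moments (`fourierInt_equilibrium`), yields the formula for `M` (`ae_eq_kernelM`). -/

theorem lintegral_mul_sq_le {α : Type*} [MeasurableSpace α] (μ : Measure α) {F G : α → ℝ≥0∞}
    (hF : AEMeasurable F μ) (hG : AEMeasurable G μ) :
    (∫⁻ t, F t * G t ∂μ) ^ 2 ≤ (∫⁻ t, F t ∂μ) * ∫⁻ t, F t * G t ^ 2 ∂μ := by
  -- Cauchy–Schwarz for the factorisation `F G = F^{1/2} · (F^{1/2} G)`.
  have h := ENNReal.lintegral_mul_le_Lp_mul_Lq μ (p := 2) (q := 2)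
    (Real.HolderConjugate.two_two) (hF.pow_const (1 / 2 : ℝ))
    ((hF.pow_const (1 / 2 : ℝ)).mul hG)
  have hhalf : ∀ t, F t ^ (1 / 2 : ℝ) * F t ^ (1 / 2 : ℝ) = F t := fun t => by
    rw [← ENNReal.rpow_add_of_nonneg _ _ (by norm_num) (by norm_num)]; norm_num
  have hhalf' : ∀ t, (F t ^ (1 / 2 : ℝ)) ^ 2 = F t := fun t => by rw [sq, hhalf]
  simp only [Pi.mul_apply, ← mul_assoc, hhalf, ENNReal.rpow_two, mul_pow, hhalf'] at h
  have h2 := pow_le_pow_left₀ (zero_le) h 2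
  refine h2.trans (le_of_eq ?_)
  rw [mul_pow]
  have : ∀ a : ℝ≥0∞, (a ^ (1 / 2 : ℝ)) ^ 2 = a := fun a => by
    rw [← ENNReal.rpow_two, ← ENNReal.rpow_mul]; norm_num
  rw [this, this]

theorem eLpNorm_two_sq {α : Type*} [MeasurableSpace α] {μ : Measure α} {F : Type*}
    [NormedAddCommGroup F] (f : α → F) :
    eLpNorm f 2 μ ^ 2 = ∫⁻ x, ‖f x‖ₑ ^ 2 ∂μ := by
  rw [eLpNorm_eq_lintegral_rpow_enorm_toReal (by norm_num) (by norm_num)]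
  rw [← ENNReal.rpow_two, ← ENNReal.rpow_mul]
  simp

/-- Young's inequality `L¹ * L² ⊆ L²`, for the integrals of the norms. -/
theorem lintegral_lconv_sq_le {f g : E → ℝ} (hf : AEStronglyMeasurable f volume)
    (hg : AEStronglyMeasurable g volume) :
    ∫⁻ x, (∫⁻ t, ‖f t‖ₑ * ‖g (x - t)‖ₑ) ^ 2 ≤ (eLpNorm f 1 volume * eLpNorm g 2 volume) ^ 2 := by
  have hmg : ∀ x, AEMeasurable (fun t => ‖g (x - t)‖ₑ) (volume : Measure E) := fun x =>
    (hg.comp_quasiMeasurePreserving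
      (quasiMeasurePreserving_sub_left_of_right_invariant volume x)).enorm
  have hmp : AEMeasurable (fun p : E × E => ‖f p.2‖ₑ * ‖g (p.1 - p.2)‖ₑ ^ 2)
      (volume.prod volume) :=
    (hf.comp_quasiMeasurePreserving Measure.quasiMeasurePreserving_snd).enorm.mul
      ((hg.comp_quasiMeasurePreserving
        (quasiMeasurePreserving_sub volume volume)).enorm.pow_const 2)
  calc ∫⁻ x, (∫⁻ t, ‖f t‖ₑ * ‖g (x - t)‖ₑ) ^ 2
      ≤ ∫⁻ x, (∫⁻ t, ‖f t‖ₑ) * ∫⁻ t, ‖f t‖ₑ * ‖g (x - t)‖ₑ ^ 2 :=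
        lintegral_mono fun x => lintegral_mul_sq_le _ hf.enorm (hmg x)
    _ = (∫⁻ t, ‖f t‖ₑ) * ∫⁻ x, ∫⁻ t, ‖f t‖ₑ * ‖g (x - t)‖ₑ ^ 2 :=
        lintegral_const_mul'' _ hmp.lintegral_prod_right'
    _ = (∫⁻ t, ‖f t‖ₑ) * ∫⁻ t, ∫⁻ x, ‖f t‖ₑ * ‖g (x - t)‖ₑ ^ 2 := by
        rw [lintegral_lintegral_swap hmp]
    _ = (∫⁻ t, ‖f t‖ₑ) * ∫⁻ t, ‖f t‖ₑ * eLpNorm g 2 volume ^ 2 := by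
        congr 1
        refine lintegral_congr fun t => ?_
        rw [lintegral_const_mul' _ _ enorm_ne_top,
          eLpNorm_two_sq, lintegral_sub_right_eq_self (fun x => ‖g x‖ₑ ^ 2) t]
    _ = _ := by
        rw [lintegral_mul_const'' _ hf.enorm, eLpNorm_one_eq_lintegral_enorm]; ring

theorem aestronglyMeasurable_conv {f g : E → ℝ} (hf : AEStronglyMeasurable f volume)
    (hg : AEStronglyMeasurable g volume) :
    AEStronglyMeasurable (f ⋆[mul ℝ ℝ] g) volume :=
  (hf.convolution_integrand (mul ℝ ℝ) hg).integral_prod_right'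

theorem eLpNorm_le_of_enorm_le_lconv {f g h : E → ℝ} (hf : AEStronglyMeasurable f volume)
    (hg : AEStronglyMeasurable g volume)
    (hh : ∀ x, ‖h x‖ₑ ≤ ∫⁻ t, ‖f t‖ₑ * ‖g (x - t)‖ₑ) :
    eLpNorm h 2 volume ≤ eLpNorm f 1 volume * eLpNorm g 2 volume := by
  rw [← ENNReal.pow_le_pow_left_iff two_ne_zero, eLpNorm_two_sq]
  exact (lintegral_mono fun x => pow_le_pow_left₀ zero_le (hh x) 2).trans
    (lintegral_lconv_sq_le hf hg)

theorem enorm_conv_le (f g : E → ℝ) (x : E) :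
    ‖(f ⋆[mul ℝ ℝ] g) x‖ₑ ≤ ∫⁻ t, ‖f t‖ₑ * ‖g (x - t)‖ₑ := by
  refine (enorm_integral_le_lintegral_enorm _).trans (le_of_eq ?_)
  simp [enorm_mul]

theorem eLpNorm_conv_le {f g : E → ℝ} (hf : AEStronglyMeasurable f volume)
    (hg : AEStronglyMeasurable g volume) :
    eLpNorm (f ⋆[mul ℝ ℝ] g) 2 volume ≤ eLpNorm f 1 volume * eLpNorm g 2 volume :=
  eLpNorm_le_of_enorm_le_lconv hf hg (enorm_conv_le f g)

theorem memLp_conv {f g : E → ℝ} (hf : Integrable f) (hg : MemLp g 2 volume) :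
    MemLp (f ⋆[mul ℝ ℝ] g) 2 volume :=
  ⟨aestronglyMeasurable_conv hf.1 hg.1, (eLpNorm_conv_le hf.1 hg.1).trans_lt
    (ENNReal.mul_lt_top (memLp_one_iff_integrable.2 hf).2 hg.2)⟩

theorem integrable_mul_comp_sub {f g : E → ℝ} (hf : MemLp f 2 volume) (hg : MemLp g 2 volume)
    (x : E) : Integrable (fun t => f t * g (x - t)) :=
  hf.integrable_mul (hg.comp_measurePreserving (Measure.measurePreserving_sub_left volume x))

/-- Convolution with an odd kernel is skew-symmetric. -/
theorem integral_conv_mul_self_eq_zero {K f : E → ℝ} (hK : Integrable K) (hodd : ∀ t, K (-t) = -K t)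
    (hf : MemLp f 2 volume) : ∫ x, (K ⋆[mul ℝ ℝ] f) x * f x = 0 := by
  -- Absolute integrability for Fubini: Cauchy–Schwarz in `x`, with Young's inequality applied to
  -- `|K| ⋆ |f|`.
  have hint : Integrable (fun p : E × E => K p.2 * f (p.1 - p.2) * f p.1)
      (volume.prod volume) := by
    have hm : AEStronglyMeasurable (fun p : E × E => K p.2 * f (p.1 - p.2) * f p.1)
        (volume.prod volume) :=
      ((hK.1.comp_quasiMeasurePreserving Measure.quasiMeasurePreserving_snd).mul
        (hf.1.comp_quasiMeasurePreserving (quasiMeasurePreserving_sub volume volume))).mul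
        (hf.1.comp_quasiMeasurePreserving Measure.quasiMeasurePreserving_fst)
    refine ⟨hm, ?_⟩
    rw [hasFiniteIntegral_iff_enorm, lintegral_prod _ hm.enorm]
    simp only [enorm_mul]
    calc ∫⁻ x, ∫⁻ t, ‖K t‖ₑ * ‖f (x - t)‖ₑ * ‖f x‖ₑ
        = ∫⁻ x, (∫⁻ t, ‖K t‖ₑ * ‖f (x - t)‖ₑ) * ‖f x‖ₑ :=
          lintegral_congr fun x => lintegral_mul_const' _ _ enorm_ne_top
      _ ≤ (∫⁻ x, (∫⁻ t, ‖K t‖ₑ * ‖f (x - t)‖ₑ) ^ 2) ^ (1 / 2 : ℝ) *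
            (∫⁻ x, ‖f x‖ₑ ^ 2) ^ (1 / 2 : ℝ) := by
          have := ENNReal.lintegral_mul_le_Lp_mul_Lq volume Real.HolderConjugate.two_two
            (f := fun x => ∫⁻ t, ‖K t‖ₑ * ‖f (x - t)‖ₑ) (g := fun x => ‖f x‖ₑ) ?_ hf.1.enorm
          · simpa using this
          · exact ((hK.1.comp_quasiMeasurePreserving Measure.quasiMeasurePreserving_snd).enorm.mul
              (hf.1.comp_quasiMeasurePreserving
                (quasiMeasurePreserving_sub volume volume)).enorm).lintegral_prod_right'
      _ < ⊤ := by
          refine ENNReal.mul_lt_top (ENNReal.rpow_lt_top_of_nonneg (by norm_num) ?_)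
            (ENNReal.rpow_lt_top_of_nonneg (by norm_num) ?_)
          · refine ((lintegral_lconv_sq_le hK.1 hf.1).trans_lt (ENNReal.pow_lt_top
              (ENNReal.mul_lt_top (memLp_one_iff_integrable.2 hK).2 hf.2))).ne
          · rw [← eLpNorm_two_sq]
            exact (ENNReal.pow_lt_top hf.2).ne
  have h1 : ∫ x, (K ⋆[mul ℝ ℝ] f) x * f x = ∫ t, K t * ∫ x, f (x - t) * f x := by
    calc ∫ x, (K ⋆[mul ℝ ℝ] f) x * f x = ∫ x, ∫ t, K t * f (x - t) * f x := by
          simp only [convolution_def, mul_apply', ← integral_mul_const]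
      _ = ∫ t, ∫ x, K t * f (x - t) * f x := integral_integral_swap hint
      _ = _ := by simp only [mul_assoc, integral_const_mul]
  -- The autocorrelation of `f` is even by translation invariance; against the odd kernel `K` it
  -- integrates to zero.
  have h2 : ∀ t : E, ∫ x, f (x - -t) * f x = ∫ x, f (x - t) * f x := fun t => by
    rw [← integral_sub_right_eq_self _ t]
    simp [mul_comm]
  have h3 : ∫ t, K t * ∫ x, f (x - t) * f x = -∫ t, K t * ∫ x, f (x - t) * f x := by
    conv_lhs => rw [← integral_neg_eq_self]
    simp only [hodd, h2, neg_mul, integral_neg]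
  rw [h1]; linarith

end Convolution

/-! ### An elementary inequality -/

/-- Choose `δ` with `(1 + δ)^k < 1 + ε`. Either `z ≤ δ q`, and the first term suffices, or `q ≤ z /
δ`, and the second does with `C = (1/δ + 1)^k`. -/
theorem exists_add_pow_le (k : ℕ) {ε : ℝ} (hε : 0 < ε) :
    ∃ C : ℝ, 0 ≤ C ∧ ∀ q z : ℝ, 0 ≤ q → 0 ≤ z → (q + z) ^ k ≤ (1 + ε) * q ^ k + C * z ^ k := by
  have hcont : Tendsto (fun δ : ℝ => (1 + δ) ^ k) (𝓝 0) (𝓝 1) := by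
    have : Continuous fun δ : ℝ => (1 + δ) ^ k := by fun_prop
    simpa using this.tendsto 0
  have hev : ∀ᶠ δ : ℝ in 𝓝[>] 0, (1 + δ) ^ k < 1 + ε :=
    (hcont.mono_left nhdsWithin_le_nhds).eventually_lt_const (by linarith)
  obtain ⟨δ, hδ, hδ0⟩ := (hev.and self_mem_nhdsWithin).exists
  replace hδ0 : 0 < δ := hδ0
  refine ⟨(1 / δ + 1) ^ k, by positivity, fun q z hq hz => ?_⟩
  rcases le_total z (δ * q) with h | h
  · calc (q + z) ^ k ≤ ((1 + δ) * q) ^ k := by gcongr; linarith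
      _ = (1 + δ) ^ k * q ^ k := mul_pow _ _ _
      _ ≤ (1 + ε) * q ^ k := by gcongr
      _ ≤ _ := le_add_of_nonneg_right (by positivity)
  · have h' : q ≤ 1 / δ * z := by
      rw [one_div, ← div_eq_inv_mul, le_div_iff₀ hδ0]; linarith
    calc (q + z) ^ k ≤ ((1 / δ + 1) * z) ^ k := by gcongr; linarith
      _ = (1 / δ + 1) ^ k * z ^ k := mul_pow _ _ _
      _ ≤ _ := le_add_of_nonneg_left (by positivity)

theorem exists_abs_norm_pow_sub_le (E : Type*) [SeminormedAddCommGroup E] (k : ℕ) {ε : ℝ}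
    (hε : 0 < ε) : ∃ C : ℝ, 0 ≤ C ∧ ∀ v t : E,
      |‖v‖ ^ k - ‖v - t‖ ^ k| ≤ ε * ‖v - t‖ ^ k + C * ‖t‖ ^ k := by
  obtain ⟨C, hC, h⟩ := exists_add_pow_le k hε
  refine ⟨C, hC, fun v t => ?_⟩
  have h1 : ‖v‖ ^ k ≤ (‖v - t‖ + ‖t‖) ^ k := by
    gcongr; simpa using norm_add_le (v - t) t
  have h2 : ‖v - t‖ ^ k ≤ (‖v‖ + ‖t‖) ^ k := by
    gcongr; exact norm_sub_le v t
  have h3 := h _ _ (norm_nonneg (v - t)) (norm_nonneg t)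
  have h4 := h _ _ (norm_nonneg v) (norm_nonneg t)
  rw [abs_le]
  constructor
  -- The roles of `v` and `v - t` are exchanged here, so the error comes out as `ε ‖v‖^k`; when the
  -- lower bound is not trivial, this is at most `ε ‖v - t‖^k`.
  · rcases le_total (‖v‖ ^ k) (‖v - t‖ ^ k) with h5 | h5
    · nlinarith
    · have : 0 ≤ ‖v - t‖ ^ k := by positivity
      have : 0 ≤ ‖t‖ ^ k := by positivity
      nlinarith
  · nlinarith

/-! ### A variant of the Lax–Milgram theorem -/

/-- The form `P(w,z) = ⟨w,z⟩ + l ⟨Jw,Jz⟩` is an equivalent inner product, and the hypothesis says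
that `P(S·,·)` is coercive. Lax–Milgram represents both forms by isomorphisms, and `S` is the
inverse of the first composed with the second. The extra term allows the `L²` part of the norm to be
reweighted without changing the space. -/
theorem bijective_of_coercive {X Y : Type*} [NormedAddCommGroup X] [InnerProductSpace ℝ X]
    [CompleteSpace X] [NormedAddCommGroup Y] [InnerProductSpace ℝ Y]
    (S : X →L[ℝ] X) (J : X →L[ℝ] Y) {c l : ℝ} (hc : 0 < c) (hl : 0 ≤ l)
    (h : ∀ w, c * ‖w‖ ^ 2 ≤ inner ℝ (S w) w + l * inner ℝ (J (S w)) (J w)) :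
    Function.Bijective S := by
  let P : X →L[ℝ] X →L[ℝ] ℝ := innerSL ℝ + l • ((innerSL ℝ (E := Y)).bilinearComp J J)
  have hP : ∀ w z, P w z = inner ℝ w z + l * inner ℝ (J w) (J z) := fun w z => by
    simp only [P, add_apply, smul_apply, bilinearComp_apply, smul_eq_mul]
    rfl
  have hPc : IsCoercive P := ⟨1, one_pos, fun w => by
    rw [hP, real_inner_self_eq_norm_sq, real_inner_self_eq_norm_sq]
    nlinarith [mul_nonneg hl (sq_nonneg ‖J w‖)]⟩
  have hQc : IsCoercive (P.comp S) := ⟨c, hc, fun w => by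
    rw [ContinuousLinearMap.comp_apply, hP]
    linarith [h w]⟩
  have heq : ∀ w, hPc.continuousLinearEquivOfBilin (S w) = hQc.continuousLinearEquivOfBilin w := by
    intro w
    refine ext_inner_right ℝ fun z => ?_
    rw [hPc.continuousLinearEquivOfBilin_apply, hQc.continuousLinearEquivOfBilin_apply]
    rfl
  have : ⇑S = hPc.continuousLinearEquivOfBilin.symm ∘ hQc.continuousLinearEquivOfBilin := by
    ext w
    rw [Function.comp_apply, ← heq, ContinuousLinearEquiv.symm_apply_apply]
  rw [this]
  exact hPc.continuousLinearEquivOfBilin.symm.bijective.comp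
    hQc.continuousLinearEquivOfBilin.bijective

/-! ### The weighted space -/

section Weighted

variable {d k : ℕ}

theorem measurable_weight : Measurable fun v : Space d => ENNReal.ofReal (1 + ‖v‖ ^ (2 * k)) := by
  fun_prop

theorem ae_weightedMeasure : ae (weightedMeasure d k) = ae (volume : Measure (Space d)) := by
  refine le_antisymm (withDensity_absolutelyContinuous _ _).ae_le
    (withDensity_absolutelyContinuous' measurable_weight.aemeasurable
      (Eventually.of_forall fun v => ?_)).ae_le
  have : 0 < 1 + ‖v‖ ^ (2 * k) := by positivity
  simpa using this

theorem aestronglyMeasurable_weightedMeasure {f : Space d → ℝ} :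
    AEStronglyMeasurable f (weightedMeasure d k) ↔ AEStronglyMeasurable f volume :=
  ⟨fun h => h.mono_ac (Measure.ae_le_iff_absolutelyContinuous.1 ae_weightedMeasure.ge),
    fun h => h.mono_ac (Measure.ae_le_iff_absolutelyContinuous.1 ae_weightedMeasure.le)⟩

theorem integrable_weightedMeasure {f : Space d → ℝ} :
    Integrable f (weightedMeasure d k) ↔ Integrable fun v => (1 + ‖v‖ ^ (2 * k)) * f v := by
  rw [weightedMeasure, integrable_withDensity_iff_integrable_smul' measurable_weight
    (Eventually.of_forall fun v => ENNReal.ofReal_lt_top)]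
  refine iff_of_eq (congrArg (fun g => Integrable g volume) (funext fun v => ?_))
  rw [ENNReal.toReal_ofReal (by positivity), smul_eq_mul]

theorem integral_weightedMeasure (f : Space d → ℝ) :
    ∫ v, f v ∂(weightedMeasure d k) = ∫ v, (1 + ‖v‖ ^ (2 * k)) * f v := by
  rw [weightedMeasure, integral_withDensity_eq_integral_toReal_smul measurable_weight
    (Eventually.of_forall fun v => ENNReal.ofReal_lt_top)]
  refine integral_congr_ae (Eventually.of_forall fun v => ?_)
  simp only
  rw [ENNReal.toReal_ofReal (by positivity), smul_eq_mul]

theorem memLp_weightedMeasure {f : Space d → ℝ} :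
    MemLp f 2 (weightedMeasure d k) ↔
      MemLp f 2 volume ∧ MemLp (fun v => ‖v‖ ^ k * f v) 2 volume := by
  have haw : ∀ {f : Space d → ℝ}, AEStronglyMeasurable f volume →
      AEStronglyMeasurable (fun v => ‖v‖ ^ k * f v) volume := fun h =>
    (by fun_prop : Continuous fun v : Space d => ‖v‖ ^ k).aestronglyMeasurable.mul h
  have hsq : ∀ v : Space d, (‖v‖ ^ k * f v) ^ 2 = ‖v‖ ^ (2 * k) * f v ^ 2 := fun v => by
    rw [mul_pow, ← pow_mul, mul_comm k]
  constructor
  · intro h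
    have hm := aestronglyMeasurable_weightedMeasure.1 h.1
    have hi := integrable_weightedMeasure.1 h.integrable_sq
    rw [memLp_two_iff_integrable_sq hm, memLp_two_iff_integrable_sq (haw hm)]
    refine ⟨hi.mono (hm.pow 2) (Eventually.of_forall fun v => ?_),
      hi.mono ((haw hm).pow 2) (Eventually.of_forall fun v => ?_)⟩
    · rw [Real.norm_of_nonneg (by positivity), Real.norm_of_nonneg (by positivity)]
      have : 0 ≤ ‖v‖ ^ (2 * k) * f v ^ 2 := by positivity
      linarith
    · rw [hsq, Real.norm_of_nonneg (by positivity), Real.norm_of_nonneg (by positivity)]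
      nlinarith [sq_nonneg (f v)]
  · rintro ⟨h1, h2⟩
    rw [memLp_two_iff_integrable_sq (aestronglyMeasurable_weightedMeasure.2 h1.1),
      integrable_weightedMeasure]
    refine (h1.integrable_sq.add h2.integrable_sq).congr (Eventually.of_forall fun v => ?_)
    simp only [Pi.add_apply, hsq]
    ring

theorem Xkv.memLp_two (w : Xkv d k) : MemLp w 2 (volume : Measure (Space d)) :=
  (memLp_weightedMeasure.1 (Lp.memLp w)).1

theorem Xkv.memLp_weight (w : Xkv d k) :
    MemLp (fun v => ‖v‖ ^ k * w v) 2 (volume : Measure (Space d)) :=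
  (memLp_weightedMeasure.1 (Lp.memLp w)).2

theorem Xkv.ext_ae {w z : Xkv d k} (h : ∀ᵐ v : Space d, w v = z v) : w = z :=
  Lp.ext (by rw [EventuallyEq, ae_weightedMeasure]; exact h)

theorem Xkv.coeFn_toLp {f : Space d → ℝ} (hf : MemLp f 2 (weightedMeasure d k)) :
    ∀ᵐ v : Space d, hf.toLp f v = f v := by
  rw [← ae_weightedMeasure (k := k)]; exact hf.coeFn_toLp

theorem Xkv.coeFn_add (w z : Xkv d k) : ∀ᵐ v : Space d, (w + z) v = w v + z v := by
  rw [← ae_weightedMeasure (k := k)]; exact Lp.coeFn_add w z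

theorem Xkv.coeFn_sub (w z : Xkv d k) : ∀ᵐ v : Space d, (w - z) v = w v - z v := by
  rw [← ae_weightedMeasure (k := k)]; exact Lp.coeFn_sub w z

theorem Xkv.coeFn_smul (c : ℝ) (w : Xkv d k) : ∀ᵐ v : Space d, (c • w) v = c * w v := by
  rw [← ae_weightedMeasure (k := k)]; exact Lp.coeFn_smul c w

theorem Xkv.inner_eq (w z : Xkv d k) : inner ℝ w z =
    (∫ v, w v * z v) + ∫ v, (‖v‖ ^ k * w v) * (‖v‖ ^ k * z v) := by
  have h := integral_add
    (w.memLp_two.integrable_mul z.memLp_two) (w.memLp_weight.integrable_mul z.memLp_weight)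
  simp only [Pi.mul_apply] at h
  rw [L2.inner_def, integral_weightedMeasure, ← h]
  refine integral_congr_ae (Eventually.of_forall fun v => ?_)
  simp only [RCLike.inner_apply, conj_trivial]
  ring

theorem Xkv.norm_sq_eq (w : Xkv d k) : ‖w‖ ^ 2 =
    (∫ v, w v ^ 2) + ∫ v, (‖v‖ ^ k * w v) ^ 2 := by
  rw [← real_inner_self_eq_norm_sq, Xkv.inner_eq]
  simp only [sq]

/-- Comparison with `(1 + |v|²)^{-k}`, which is integrable exactly because `2k > d`; convexity of
the power costs the factor `2^{k-1}`. -/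
theorem integrable_inv_add_norm_pow (hk : d < 2 * k) {L : ℝ} (hL : 1 ≤ L) :
    Integrable fun v : Space d => (L + ‖v‖ ^ (2 * k))⁻¹ := by
  have h := (integrable_rpow_neg_one_add_norm_sq (E := Space d) (μ := volume) (r := (2 * k : ℕ))
    (by simpa using mod_cast hk)).const_mul ((2 : ℝ) ^ (k - 1))
  refine h.mono (by fun_prop) (Eventually.of_forall fun v => ?_)
  have h1 : (1 + ‖v‖ ^ (2 : ℕ)) ^ (-((2 * k : ℕ) : ℝ) / 2) = ((1 + ‖v‖ ^ (2 : ℕ)) ^ k)⁻¹ := by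
    rw [← Real.rpow_natCast _ k, ← Real.rpow_neg (by positivity)]
    congr 1; push_cast; ring
  rw [h1, Real.norm_of_nonneg (by positivity), Real.norm_of_nonneg (by positivity),
    ← div_eq_mul_inv, inv_eq_one_div, div_le_div_iff₀ (by positivity) (by positivity), one_mul]
  calc (1 + ‖v‖ ^ 2) ^ k ≤ 2 ^ (k - 1) * (1 ^ k + (‖v‖ ^ 2) ^ k) :=
        add_pow_le zero_le_one (by positivity) k
    _ ≤ _ := by rw [one_pow, ← pow_mul]; gcongr

/-- The integral of `(L + |v|^{2k})⁻¹`. -/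
def tailConst (d k : ℕ) (L : ℝ) : ℝ := ∫ v : Space d, (L + ‖v‖ ^ (2 * k))⁻¹

theorem tendsto_tailConst (hk : d < 2 * k) : Tendsto (tailConst d k) atTop (𝓝 0) := by
  have h := tendsto_integral_filter_of_dominated_convergence (μ := (volume : Measure (Space d)))
    (l := atTop) (F := fun (L : ℝ) (v : Space d) => (L + ‖v‖ ^ (2 * k))⁻¹) (f := fun _ => 0)
    (fun v => (1 + ‖v‖ ^ (2 * k))⁻¹) (Eventually.of_forall fun L => by fun_prop) ?_
    (integrable_inv_add_norm_pow hk le_rfl) (Eventually.of_forall fun v => ?_)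
  · rw [integral_zero] at h; exact h
  · filter_upwards [eventually_ge_atTop 1] with L hL
    refine Eventually.of_forall fun v => ?_
    rw [Real.norm_of_nonneg (by positivity)]
    gcongr
  · exact tendsto_inv_atTop_zero.comp (tendsto_atTop_add_const_right _ _ tendsto_id)

/-- Cauchy–Schwarz for `|f| = ρ⁻¹ · ρ|f|` with `ρ² = L + |v|^{2k}`. The parameter `L` is kept free
because `tailConst d k L` tends to 0: the `L¹` norm becomes a small perturbation once `L` is large.
-/
theorem integrable_of_memLp_weight (hk : d < 2 * k) {f : Space d → ℝ} (h1 : MemLp f 2 volume)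
    (h2 : MemLp (fun v => ‖v‖ ^ k * f v) 2 volume) {L : ℝ} (hL : 1 ≤ L) :
    Integrable f ∧ (∫ v, |f v|) ^ 2 ≤
      tailConst d k L * (L * (∫ v, f v ^ 2) + ∫ v, (‖v‖ ^ k * f v) ^ 2) := by
  set ρ : Space d → ℝ := fun v => Real.sqrt (L + ‖v‖ ^ (2 * k)) with hρ
  have hL0 : 0 < L := one_pos.trans_le hL
  have hρpos : ∀ v : Space d, 0 < L + ‖v‖ ^ (2 * k) := fun v => by positivity
  have hρc : Continuous ρ := by fun_prop
  have hρ0 : ∀ v, ρ v ≠ 0 := fun v => (Real.sqrt_pos.2 (hρpos v)).ne'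
  have hA : MemLp (fun v => (ρ v)⁻¹) 2 (volume : Measure (Space d)) := by
    have hm : AEStronglyMeasurable (fun v => (ρ v)⁻¹) (volume : Measure (Space d)) :=
      (hρc.inv₀ hρ0).aestronglyMeasurable
    rw [memLp_two_iff_integrable_sq hm]
    refine (integrable_inv_add_norm_pow hk hL).congr (Eventually.of_forall fun v => ?_)
    simp only [hρ]
    rw [inv_pow, Real.sq_sqrt (hρpos v).le]
  have hsq : ∀ v, (ρ v * |f v|) ^ 2 = L * f v ^ 2 + (‖v‖ ^ k * f v) ^ 2 := fun v => by
    rw [mul_pow, sq_abs, hρ, Real.sq_sqrt (hρpos v).le, mul_pow, ← pow_mul, mul_comm k]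
    ring
  have hB : MemLp (fun v => ρ v * |f v|) 2 (volume : Measure (Space d)) := by
    have hm : AEStronglyMeasurable (fun v => ρ v * |f v|) (volume : Measure (Space d)) :=
      hρc.aestronglyMeasurable.mul h1.1.norm
    rw [memLp_two_iff_integrable_sq hm]
    simp only [hsq]
    exact (h1.integrable_sq.const_mul L).add h2.integrable_sq
  have heq : ∀ v, (ρ v)⁻¹ * (ρ v * |f v|) = |f v| := fun v => inv_mul_cancel_left₀ (hρ0 v) _
  have hint : Integrable fun v => |f v| :=
    (hA.integrable_mul hB).congr (Eventually.of_forall heq)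
  refine ⟨(integrable_norm_iff h1.1).1 hint, ?_⟩
  have hcs := integral_mul_le_Lp_mul_Lq_of_nonneg (μ := (volume : Measure (Space d)))
    Real.HolderConjugate.two_two (f := fun v => (ρ v)⁻¹) (g := fun v => ρ v * |f v|)
    (Eventually.of_forall fun v => by positivity) (Eventually.of_forall fun v => by positivity)
    (by simpa using hA) (by simpa using hB)
  simp only [heq, Real.rpow_two, hsq, ← Real.sqrt_eq_rpow] at hcs
  have hinv : ∀ v, (ρ v)⁻¹ ^ 2 = (L + ‖v‖ ^ (2 * k))⁻¹ := fun v => by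
    rw [inv_pow, hρ, Real.sq_sqrt (hρpos v).le]
  simp only [hinv] at hcs
  rw [integral_add (h1.integrable_sq.const_mul L) h2.integrable_sq, integral_const_mul] at hcs
  calc (∫ v, |f v|) ^ 2 ≤ _ := pow_le_pow_left₀ (integral_nonneg fun v => abs_nonneg _) hcs 2
    _ = _ := by
      rw [mul_pow, Real.sq_sqrt, Real.sq_sqrt]; · rfl
      · positivity
      · exact integral_nonneg fun v => (inv_pos.2 (hρpos v)).le

theorem Xkv.integrable (hk : d < 2 * k) (w : Xkv d k) : Integrable (w : Space d → ℝ) :=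
  (integrable_of_memLp_weight hk w.memLp_two w.memLp_weight le_rfl).1

end Weighted

/-! ### Convolution operators on the weighted space -/

section ConvolutionOperator

theorem lpNorm_two_sq {α : Type*} [MeasurableSpace α] {μ : Measure α} {f : α → ℝ}
    (hf : MemLp f 2 μ) : lpNorm f 2 μ ^ 2 = ∫ x, f x ^ 2 ∂μ := by
  rw [lpNorm_eq_integral_norm_rpow_toReal (by norm_num) (by norm_num) hf.1]
  simp only [ENNReal.toReal_ofNat, Real.rpow_two, Real.norm_eq_abs, sq_abs]
  rw [← one_div, ← Real.sqrt_eq_rpow, Real.sq_sqrt (integral_nonneg fun x => sq_nonneg _)]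

theorem abs_integral_mul_le {α : Type*} [MeasurableSpace α] {μ : Measure α} {f g : α → ℝ}
    (hf : MemLp f 2 μ) (hg : MemLp g 2 μ) :
    |∫ x, f x * g x ∂μ| ≤ lpNorm f 2 μ * lpNorm g 2 μ := by
  have h := integral_mul_norm_le_Lp_mul_Lq (μ := μ) Real.HolderConjugate.two_two
    (f := f) (g := g) (by simpa using hf) (by simpa using hg)
  rw [lpNorm_eq_integral_norm_rpow_toReal (by norm_num) (by norm_num) hf.1,
    lpNorm_eq_integral_norm_rpow_toReal (by norm_num) (by norm_num) hg.1]
  refine (abs_integral_le_integral_abs).trans ?_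
  simpa [abs_mul] using h

variable {E : Type*} [NormedAddCommGroup E] [InnerProductSpace ℝ E] [FiniteDimensional ℝ E]
  [MeasurableSpace E] [BorelSpace E]

theorem lpNorm_conv_le {f g : E → ℝ} (hf : Integrable f) (hg : MemLp g 2 volume) :
    lpNorm (f ⋆[mul ℝ ℝ] g) 2 volume ≤ (∫ x, |f x|) * lpNorm g 2 volume := by
  have h := ENNReal.toReal_mono (ENNReal.mul_ne_top (memLp_one_iff_integrable.2 hf).2.ne hg.2.ne)
    (eLpNorm_conv_le hf.1 hg.1)
  rwa [ENNReal.toReal_mul, toReal_eLpNorm (aestronglyMeasurable_conv hf.1 hg.1),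
    toReal_eLpNorm hf.1, toReal_eLpNorm hg.1, lpNorm_one_eq_integral_norm hf.1] at h

theorem conv_comm (f g : E → ℝ) : f ⋆[mul ℝ ℝ] g = g ⋆[mul ℝ ℝ] f := by
  conv_lhs => rw [← convolution_flip]
  congr 1
  ext; simp

/-- The commutator has the integral kernel `(a(v) - a(v-t)) K(t)`. The assumption on `a` moves the
weight to `w` at the small cost `ε`, or to `K` at the cost `C`; in the second case `w` only enters
through its `L¹` norm after Young's inequality. -/
theorem abs_commutator_le {K w : E → ℝ} {a : E → ℝ} (hK : MemLp K 2 volume)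
    (hw : MemLp w 2 volume) (haK : MemLp (fun v => a v * K v) 2 volume)
    (haw : MemLp (fun v => a v * w v) 2 volume) (ha0 : ∀ v, 0 ≤ a v) {ε C : ℝ}
    (ha : ∀ v t, |a v - a (v - t)| ≤ ε * a (v - t) + C * a t) (v : E) :
    |a v * (K ⋆[mul ℝ ℝ] w) v - (K ⋆[mul ℝ ℝ] fun u => a u * w u) v| ≤
      ε * ((fun t => |K t|) ⋆[mul ℝ ℝ] fun u => |a u * w u|) v +
      C * ((fun u => |w u|) ⋆[mul ℝ ℝ] fun t => |a t * K t|) v := by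
  have i1 := integrable_mul_comp_sub hK hw v
  have i2 := integrable_mul_comp_sub hK haw v
  have i3 := integrable_mul_comp_sub hK.norm haw.norm v
  have i4 := integrable_mul_comp_sub haK.norm hw.norm v
  simp only [Real.norm_eq_abs] at i3 i4
  rw [conv_comm (fun u => |w u|)]
  simp only [convolution_def, mul_apply']
  rw [← integral_const_mul, ← integral_sub (i1.const_mul _) i2, ← integral_const_mul,
    ← integral_const_mul, ← integral_add (i3.const_mul _) (i4.const_mul _)]
  refine abs_integral_le_integral_abs.trans (integral_mono_of_nonneg
    (Eventually.of_forall fun t => abs_nonneg _) ((i3.const_mul _).add (i4.const_mul _))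
    (Eventually.of_forall fun t => ?_))
  simp only
  have h1 : a v * (K t * w (v - t)) - K t * (a (v - t) * w (v - t)) =
      (a v - a (v - t)) * (K t * w (v - t)) := by ring
  rw [h1, abs_mul, abs_mul (K t), abs_mul (a t), abs_mul (a (v - t)), abs_of_nonneg (ha0 t),
    abs_of_nonneg (ha0 (v - t))]
  calc |a v - a (v - t)| * (|K t| * |w (v - t)|)
      ≤ (ε * a (v - t) + C * a t) * (|K t| * |w (v - t)|) := by gcongr; exact ha v t
    _ = _ := by ring

/-- The commutator of a convolution operator with the multiplication by a weight. -/
theorem memLp_commutator {K w : E → ℝ} {a : E → ℝ} (hac : Continuous a) (hK : MemLp K 2 volume)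
    (hK1 : Integrable K) (hw : MemLp w 2 volume) (hw1 : Integrable w)
    (haK : MemLp (fun v => a v * K v) 2 volume)
    (haw : MemLp (fun v => a v * w v) 2 volume) (ha0 : ∀ v, 0 ≤ a v) {ε C : ℝ} (hε : 0 ≤ ε)
    (hC : 0 ≤ C) (ha : ∀ v t, |a v - a (v - t)| ≤ ε * a (v - t) + C * a t) :
    MemLp (fun v => a v * (K ⋆[mul ℝ ℝ] w) v - (K ⋆[mul ℝ ℝ] fun u => a u * w u) v) 2 volume ∧
    lpNorm (fun v => a v * (K ⋆[mul ℝ ℝ] w) v - (K ⋆[mul ℝ ℝ] fun u => a u * w u) v) 2 volume ≤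
      ε * ((∫ t, |K t|) * lpNorm (fun v => a v * w v) 2 volume) +
      C * ((∫ t, |w t|) * lpNorm (fun v => a v * K v) 2 volume) := by
  set F : E → ℝ := (fun t => |K t|) ⋆[mul ℝ ℝ] fun u => |a u * w u| with hF
  set G : E → ℝ := (fun u => |w u|) ⋆[mul ℝ ℝ] fun t => |a t * K t| with hG
  have hFm : MemLp F 2 volume := memLp_conv hK1.norm haw.norm
  have hGm : MemLp G 2 volume := memLp_conv hw1.norm haK.norm
  have hFG : MemLp (ε • F + C • G) 2 volume := (hFm.const_smul ε).add (hGm.const_smul C)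
  have hle := abs_commutator_le hK hw haK haw ha0 ha
  constructor
  · refine hFG.mono ((hac.aestronglyMeasurable.mul (aestronglyMeasurable_conv hK.1 hw.1)).sub
      (aestronglyMeasurable_conv hK.1 haw.1)) (Eventually.of_forall fun v => ?_)
    exact (hle v).trans (le_abs_self _)
  · refine (lpNorm_mono_real hFG fun v => hle v).trans
      ((lpNorm_add_le (hFm.const_smul ε) (by norm_num)).trans ?_)
    have h1 := lpNorm_conv_le hK1.norm haw.norm
    have h2 := lpNorm_conv_le hw1.norm haK.norm
    rw [lpNorm_norm haw.1] at h1
    rw [lpNorm_norm haK.1] at h2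
    simp only [Real.norm_eq_abs, abs_abs] at h1 h2
    rw [lpNorm_const_smul, lpNorm_const_smul, coe_nnnorm, coe_nnnorm, Real.norm_of_nonneg hε,
      Real.norm_of_nonneg hC]
    gcongr

/-! ### Boundedness and resolvent of convolution operators on `X_k^v` -/

variable {d k : ℕ}

/-- The weighted convolution is the commutator plus `K ⋆ (|·|^k w)`, both in `L²`. No smallness is
needed here, so `ε = 1`. -/
theorem memLp_weighted_conv (hk : d < 2 * k) {K w : Space d → ℝ}
    (hK : MemLp K 2 (weightedMeasure d k)) (hw : MemLp w 2 (weightedMeasure d k)) :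
    MemLp (K ⋆[mul ℝ ℝ] w) 2 (weightedMeasure d k) := by
  rw [memLp_weightedMeasure] at hK hw ⊢
  have hK1 := (integrable_of_memLp_weight hk hK.1 hK.2 le_rfl).1
  have hw1 := (integrable_of_memLp_weight hk hw.1 hw.2 le_rfl).1
  obtain ⟨C, hC, ha⟩ := exists_abs_norm_pow_sub_le (Space d) k one_pos
  refine ⟨memLp_conv hK1 hw.1, ?_⟩
  have h := (memLp_commutator (by fun_prop) hK.1 hK1 hw.1 hw1 hK.2 hw.2
    (fun v => by positivity) zero_le_one hC ha).1.add (memLp_conv hK1 hw.2)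
  refine h.ae_eq (Eventually.of_forall fun v => ?_)
  simp

theorem exists_lpNorm_weighted_conv_le (hk : d < 2 * k) {K : Space d → ℝ}
    (hK : MemLp K 2 (weightedMeasure d k)) :
    ∃ B : ℝ, ∀ w : Xkv d k, ‖(memLp_weighted_conv hk hK (Lp.memLp w)).toLp‖ ≤ B * ‖w‖ := by
  have hK' := memLp_weightedMeasure.1 hK
  have hK1 := (integrable_of_memLp_weight hk hK'.1 hK'.2 le_rfl).1
  obtain ⟨C, hC, ha⟩ := exists_abs_norm_pow_sub_le (Space d) k one_pos
  set κ := ∫ t, |K t|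
  set m := lpNorm (fun v => ‖v‖ ^ k * K v) 2 volume
  have hκ : 0 ≤ κ := integral_nonneg fun t => abs_nonneg _
  have hm : 0 ≤ m := lpNorm_nonneg
  -- The first `κ` bounds the unweighted norm; the bracket collects the commutator bound with `ε =
  -- 1` and then Young's inequality for `K ⋆ (|·|^k w)`.
  refine ⟨κ + (κ + C * (√(tailConst d k 1) * m) + κ), fun w => ?_⟩
  have hw1 := w.integrable hk
  have hnorm : ∀ z : Xkv d k, ‖z‖ ^ 2 = lpNorm z 2 volume ^ 2 +
      lpNorm (fun v => ‖v‖ ^ k * z v) 2 volume ^ 2 := fun z => by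
    rw [lpNorm_two_sq z.memLp_two, lpNorm_two_sq z.memLp_weight, z.norm_sq_eq]
  have hp : lpNorm w 2 volume ≤ ‖w‖ := by
    refine le_of_sq_le_sq ?_ (norm_nonneg _)
    rw [hnorm]; exact le_add_of_nonneg_right (sq_nonneg _)
  have hq : lpNorm (fun v => ‖v‖ ^ k * w v) 2 volume ≤ ‖w‖ := by
    refine le_of_sq_le_sq ?_ (norm_nonneg _)
    rw [hnorm]; exact le_add_of_nonneg_left (sq_nonneg _)
  have hr : ∫ v, |w v| ≤ √(tailConst d k 1) * ‖w‖ := by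
    have h := (integrable_of_memLp_weight hk w.memLp_two w.memLp_weight le_rfl).2
    rw [one_mul, ← w.norm_sq_eq] at h
    rw [← Real.sqrt_sq (norm_nonneg w), ← Real.sqrt_mul' _ (sq_nonneg _)]
    exact Real.le_sqrt_of_sq_le h
  obtain ⟨hD, hDle⟩ := memLp_commutator (by fun_prop) hK'.1 hK1 w.memLp_two hw1 hK'.2 w.memLp_weight
    (fun v => by positivity) zero_le_one hC ha
  set D := fun v => ‖v‖ ^ k * (K ⋆[mul ℝ ℝ] w) v - (K ⋆[mul ℝ ℝ] fun u => ‖u‖ ^ k * w u) v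
  set z : Xkv d k := (memLp_weighted_conv hk hK (Lp.memLp w)).toLp
  have hz : ∀ᵐ v : Space d, z v = (K ⋆[mul ℝ ℝ] w) v := Xkv.coeFn_toLp _
  have hz1 : lpNorm z 2 volume ≤ κ * ‖w‖ := by
    rw [← toReal_eLpNorm z.memLp_two.1, eLpNorm_congr_ae hz,
      toReal_eLpNorm (aestronglyMeasurable_conv hK1.1 hw1.1)]
    exact (lpNorm_conv_le hK1 w.memLp_two).trans (by gcongr)
  have hz2 : lpNorm (fun v => ‖v‖ ^ k * z v) 2 volume ≤
      (κ + C * (√(tailConst d k 1) * m) + κ) * ‖w‖ := by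
    have hae : (fun v => ‖v‖ ^ k * z v) =ᵐ[volume]
        D + (K ⋆[mul ℝ ℝ] fun u => ‖u‖ ^ k * w u) := by
      filter_upwards [hz] with v hv
      simp [D, hv]
    have hcm := memLp_conv hK1 w.memLp_weight
    rw [← toReal_eLpNorm z.memLp_weight.1, eLpNorm_congr_ae hae,
      toReal_eLpNorm (hD.add hcm).1]
    refine (lpNorm_add_le hD (by norm_num)).trans ?_
    have h3 := lpNorm_conv_le hK1 w.memLp_weight
    calc _ ≤ (1 * (κ * ‖w‖) + C * ((√(tailConst d k 1) * ‖w‖) * m)) + κ * ‖w‖ := by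
          refine add_le_add (hDle.trans ?_) (h3.trans ?_) <;> gcongr
      _ = _ := by ring
  rw [add_mul]
  refine le_of_sq_le_sq ?_ (by positivity)
  rw [hnorm]
  have h0 : 0 ≤ lpNorm z 2 volume := lpNorm_nonneg
  have h0' : 0 ≤ lpNorm (fun v => ‖v‖ ^ k * z v) 2 volume := lpNorm_nonneg
  nlinarith

/-- The convolution with `K` as a bounded operator on `Xkv d k`. -/
def convOp (hk : d < 2 * k) {K : Space d → ℝ} (hK : MemLp K 2 (weightedMeasure d k)) :
    Xkv d k →L[ℝ] Xkv d k :=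
  LinearMap.mkContinuousOfExistsBound
    { toFun := fun w => (memLp_weighted_conv hk hK (Lp.memLp w)).toLp
      map_add' := fun w z => by
        refine Xkv.ext_ae ?_
        filter_upwards [Xkv.coeFn_toLp (memLp_weighted_conv hk hK (Lp.memLp w)),
          Xkv.coeFn_toLp (memLp_weighted_conv hk hK (Lp.memLp z)),
          Xkv.coeFn_toLp (memLp_weighted_conv hk hK (Lp.memLp (w + z))),
          Xkv.coeFn_add (memLp_weighted_conv hk hK (Lp.memLp w)).toLp
            (memLp_weighted_conv hk hK (Lp.memLp z)).toLp] with v h1 h2 h3 h4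
        have hK2 := (memLp_weightedMeasure.1 hK).1
        rw [h3, h4, h1, h2, convolution_congr (mul ℝ ℝ) (ae_eq_refl K)
          (g := (w + z : Xkv d k)) (g' := (w : Space d → ℝ) + z) (Xkv.coeFn_add w z)]
        have e1 : ConvolutionExistsAt K w v (mul ℝ ℝ) volume :=
          integrable_mul_comp_sub hK2 w.memLp_two v
        have e2 : ConvolutionExistsAt K z v (mul ℝ ℝ) volume :=
          integrable_mul_comp_sub hK2 z.memLp_two v
        exact e1.distrib_add e2
      map_smul' := fun c w => by
        refine Xkv.ext_ae ?_
        filter_upwards [Xkv.coeFn_toLp (memLp_weighted_conv hk hK (Lp.memLp w)),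
          Xkv.coeFn_toLp (memLp_weighted_conv hk hK (Lp.memLp (c • w))),
          Xkv.coeFn_smul c (memLp_weighted_conv hk hK (Lp.memLp w)).toLp] with v h1 h3 h4
        rw [h3, RingHom.id_apply, h4, h1, convolution_congr (mul ℝ ℝ) (ae_eq_refl K)
          (g := (c • w : Xkv d k)) (g' := c • (w : Space d → ℝ)) (Xkv.coeFn_smul c w),
          convolution_smul]
        rfl }
    (exists_lpNorm_weighted_conv_le hk hK)

theorem convOp_coeFn (hk : d < 2 * k) {K : Space d → ℝ} (hK : MemLp K 2 (weightedMeasure d k))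
    (w : Xkv d k) : ∀ᵐ v : Space d, convOp hk hK w v = (K ⋆[mul ℝ ℝ] w) v :=
  Xkv.coeFn_toLp (memLp_weighted_conv hk hK (Lp.memLp w))

/-- The inclusion of the weighted space into `L²`. -/
def inclL2 (d k : ℕ) : Xkv d k →L[ℝ] Lp ℝ 2 (volume : Measure (Space d)) :=
  LinearMap.mkContinuous
    { toFun := fun w => w.memLp_two.toLp
      map_add' := fun w z => by
        refine Lp.ext ?_
        filter_upwards [w.memLp_two.coeFn_toLp, z.memLp_two.coeFn_toLp,
          (w + z).memLp_two.coeFn_toLp, Xkv.coeFn_add w z,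
          Lp.coeFn_add w.memLp_two.toLp z.memLp_two.toLp] with v h1 h2 h3 h4 h5
        rw [h3, h4, h5, Pi.add_apply, h1, h2]
      map_smul' := fun c w => by
        refine Lp.ext ?_
        filter_upwards [w.memLp_two.coeFn_toLp, (c • w).memLp_two.coeFn_toLp, Xkv.coeFn_smul c w,
          Lp.coeFn_smul c w.memLp_two.toLp] with v h1 h3 h4 h5
        rw [h3, h4, RingHom.id_apply, h5, Pi.smul_apply, h1, smul_eq_mul] }
    1 (fun w => by
      have h : ‖w.memLp_two.toLp‖ = lpNorm w 2 volume := by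
        rw [Lp.norm_toLp, toReal_eLpNorm w.memLp_two.1]
      have h2 := w.norm_sq_eq
      rw [← lpNorm_two_sq w.memLp_two, ← lpNorm_two_sq w.memLp_weight] at h2
      rw [one_mul]
      change ‖w.memLp_two.toLp‖ ≤ _
      rw [h]
      refine le_of_sq_le_sq ?_ (norm_nonneg _)
      rw [h2]; exact le_add_of_nonneg_right (sq_nonneg _))

theorem inner_inclL2 (w z : Xkv d k) : inner ℝ (inclL2 d k w) (inclL2 d k z) =
    ∫ v, w v * z v := by
  rw [L2.inner_def]
  refine integral_congr_ae ?_
  filter_upwards [w.memLp_two.coeFn_toLp, z.memLp_two.coeFn_toLp] with v h1 h2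
  change inner ℝ (w.memLp_two.toLp w v) (z.memLp_two.toLp z v) = _
  rw [h1, h2, RCLike.inner_apply, conj_trivial, mul_comm]

/-- The resolvent of the convolution with an odd kernel exists on the whole positive half-axis. -/
theorem bijective_sub_convOp (hk : d < 2 * k) {K : Space d → ℝ}
    (hK : MemLp K 2 (weightedMeasure d k)) (hodd : ∀ t, K (-t) = -K t) {ν : ℝ} (hν : 0 < ν) :
    Function.Bijective (ν • ContinuousLinearMap.id ℝ (Xkv d k) - convOp hk hK) := by
  have hK' := memLp_weightedMeasure.1 hK
  have hK1 := (integrable_of_memLp_weight hk hK'.1 hK'.2 le_rfl).1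
  set κ := ∫ t, |K t|
  set m := lpNorm (fun v => ‖v‖ ^ k * K v) 2 volume
  have hκ : 0 ≤ κ := integral_nonneg fun t => abs_nonneg _
  have hm : 0 ≤ m := lpNorm_nonneg
  -- The commutator may absorb `ν/2` in all: one quarter is spent on `ε`, the other on `L`. Since
  -- `C` depends on `ε`, the choice of `L` comes last.
  obtain ⟨ε, hε, hεκ⟩ : ∃ ε > 0, ε * κ ≤ ν / 4 := by
    refine ⟨ν / (4 * (κ + 1)), by positivity, ?_⟩
    rw [div_mul_eq_mul_div, div_le_div_iff₀ (by positivity) (by norm_num)]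
    nlinarith
  obtain ⟨C, hC, ha⟩ := exists_abs_norm_pow_sub_le (Space d) k hε
  obtain ⟨L, hL, hLC⟩ : ∃ L ≥ 1, C * m * √(tailConst d k L) ≤ ν / 4 := by
    have h : Tendsto (fun L => C * m * √(tailConst d k L)) atTop (𝓝 (C * m * √0)) :=
      ((tendsto_tailConst hk).sqrt).const_mul _
    rw [Real.sqrt_zero, mul_zero] at h
    obtain ⟨L, h1, h2⟩ := ((eventually_ge_atTop 1).and
      (h.eventually_le_const (show (0 : ℝ) < ν / 4 by positivity))).exists
    exact ⟨L, h1, h2⟩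
  -- The inner product of `X_k^v` already contains the `L²` product once, so `l = L - 1` produces
  -- the weight `L + |v|^{2k}`.
  refine bijective_of_coercive _ (inclL2 d k) (c := ν / 2) (l := L - 1) (by positivity)
    (by linarith) fun w => ?_
  have hw1 := w.integrable hk
  set z := (ν • ContinuousLinearMap.id ℝ (Xkv d k) - convOp hk hK) w with hz
  have hzae : ∀ᵐ v : Space d, z v = ν * w v - (K ⋆[mul ℝ ℝ] w) v := by
    filter_upwards [convOp_coeFn hk hK w, Xkv.coeFn_sub (ν • w) (convOp hk hK w),
      Xkv.coeFn_smul ν w] with v h1 h2 h3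
    rw [← h1, ← h3, ← h2]; rfl
  obtain ⟨hD, hDle⟩ := memLp_commutator (by fun_prop) hK'.1 hK1 w.memLp_two hw1 hK'.2 w.memLp_weight
    (fun v => by positivity) hε.le hC ha
  set D := fun v => ‖v‖ ^ k * (K ⋆[mul ℝ ℝ] w) v - (K ⋆[mul ℝ ℝ] fun u => ‖u‖ ^ k * w u) v
    with hDdef
  have hcw := memLp_conv hK1 w.memLp_two
  have hcaw := memLp_conv hK1 w.memLp_weight
  set p := lpNorm w 2 volume with hp
  set q := lpNorm (fun v => ‖v‖ ^ k * w v) 2 volume with hq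
  set r := ∫ v, |w v|
  have hq0 : 0 ≤ q := lpNorm_nonneg
  have hr0 : 0 ≤ r := integral_nonneg fun t => abs_nonneg _
  have e1 : ∫ v, z v * w v = ν * p ^ 2 := by
    have hw2 : ∫ v, w v ^ 2 = p ^ 2 := (lpNorm_two_sq w.memLp_two).symm
    calc ∫ v, z v * w v = ∫ v, (ν * w v ^ 2 - (K ⋆[mul ℝ ℝ] w) v * w v) := by
          refine integral_congr_ae ?_
          filter_upwards [hzae] with v hv
          rw [hv]; ring
      _ = ν * p ^ 2 := by
          have i2 : Integrable fun v => (K ⋆[mul ℝ ℝ] w) v * w v := hcw.integrable_mul w.memLp_two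
          rw [integral_sub (w.memLp_two.integrable_sq.const_mul ν) i2, integral_const_mul, hw2,
            integral_conv_mul_self_eq_zero hK1 hodd w.memLp_two, sub_zero]
  -- Moving the weight inside the convolution leaves `D` and a term that vanishes by skew-symmetry,
  -- now applied to `|v|^k w`.
  have e2 : ∫ v, (‖v‖ ^ k * z v) * (‖v‖ ^ k * w v) =
      ν * q ^ 2 - ∫ v, D v * (‖v‖ ^ k * w v) := by
    have hw2 : ∫ v, (‖v‖ ^ k * w v) ^ 2 = q ^ 2 := (lpNorm_two_sq w.memLp_weight).symm
    have i1 := w.memLp_weight.integrable_sq.const_mul ν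
    have i2 : Integrable fun v => D v * (‖v‖ ^ k * w v) := hD.integrable_mul w.memLp_weight
    have i12 : Integrable fun v => ν * (‖v‖ ^ k * w v) ^ 2 - D v * (‖v‖ ^ k * w v) := i1.sub i2
    have i3 : Integrable fun v => (K ⋆[mul ℝ ℝ] fun u => ‖u‖ ^ k * w u) v * (‖v‖ ^ k * w v) :=
      hcaw.integrable_mul w.memLp_weight
    calc ∫ v, (‖v‖ ^ k * z v) * (‖v‖ ^ k * w v)
        = ∫ v, (ν * (‖v‖ ^ k * w v) ^ 2 - D v * (‖v‖ ^ k * w v) -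
            (K ⋆[mul ℝ ℝ] fun u => ‖u‖ ^ k * w u) v * (‖v‖ ^ k * w v)) := by
          refine integral_congr_ae ?_
          filter_upwards [hzae] with v hv
          rw [hv, hDdef]; ring
      _ = _ := by
          rw [integral_sub i12 i3, integral_sub i1 i2, integral_const_mul, hw2,
            integral_conv_mul_self_eq_zero hK1 hodd w.memLp_weight, sub_zero]
  have hDq : |∫ v, D v * (‖v‖ ^ k * w v)| ≤ (ε * (κ * q) + C * (r * m)) * q :=
    (abs_integral_mul_le hD w.memLp_weight).trans (mul_le_mul_of_nonneg_right hDle hq0)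
  have hr : r ≤ √(tailConst d k L) * √(L * p ^ 2 + q ^ 2) := by
    have h := (integrable_of_memLp_weight hk w.memLp_two w.memLp_weight hL).2
    rw [← lpNorm_two_sq w.memLp_two, ← lpNorm_two_sq w.memLp_weight] at h
    rw [← Real.sqrt_mul' _ (by positivity)]
    exact Real.le_sqrt_of_sq_le h
  -- `N` is the norm of `w` in the modified inner product. The form equals `ν N²` up to a commutator
  -- term of size at most `(ν/2) N²`.
  set N := √(L * p ^ 2 + q ^ 2) with hN
  have hNsq : N ^ 2 = L * p ^ 2 + q ^ 2 := Real.sq_sqrt (by positivity)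
  have hN0 : 0 ≤ N := Real.sqrt_nonneg _
  have hqN : q ≤ N := Real.le_sqrt_of_sq_le (by
    have : 0 ≤ L * p ^ 2 := by positivity
    linarith)
  have hbound : (ε * (κ * q) + C * (r * m)) * q ≤ ν / 2 * N ^ 2 := by
    calc (ε * (κ * q) + C * (r * m)) * q
        ≤ (ε * (κ * N) + C * ((√(tailConst d k L) * N) * m)) * N := by gcongr
      _ = (ε * κ + C * m * √(tailConst d k L)) * N ^ 2 := by ring
      _ ≤ (ν / 4 + ν / 4) * N ^ 2 := by gcongr
      _ = _ := by ring
  rw [Xkv.inner_eq, inner_inclL2, e1, e2, w.norm_sq_eq, ← lpNorm_two_sq w.memLp_two,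
    ← lpNorm_two_sq w.memLp_weight]
  have h5 := (abs_le.1 hDq).2
  have h6 : ν / 2 * (p ^ 2 + q ^ 2) ≤ ν / 2 * N ^ 2 := by
    rw [hNsq]; gcongr
    nlinarith [sq_nonneg p]
  have h7 : ν * N ^ 2 = ν * (L * p ^ 2 + q ^ 2) := by rw [hNsq]
  linarith

end ConvolutionOperator

/-! ### Fourier inversion almost everywhere -/

section Fourier

variable {E : Type*} [NormedAddCommGroup E] [InnerProductSpace ℝ E] [FiniteDimensional ℝ E]
  [MeasurableSpace E] [BorelSpace E]

theorem integral_fourier_mul_eq {f g : E → ℂ} (hf : Integrable f) (hg : Integrable g) :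
    ∫ x, 𝓕 f x * g x = ∫ x, f x * 𝓕 g x := by
  have h := VectorFourier.integral_fourierIntegral_smul_eq_flip (μ := (volume : Measure E))
    (ν := (volume : Measure E)) (L := innerₗ E) Real.continuous_fourierChar continuous_inner hf hg
  rw [flip_innerₗ] at h
  exact h

theorem continuous_fourier_of_integrable {f : E → ℂ} (hf : Integrable f) : Continuous (𝓕 f) :=
  VectorFourier.fourierIntegral_continuous Real.continuous_fourierChar continuous_inner hf

theorem continuous_fourierInv_of_integrable {f : E → ℂ} (hf : Integrable f) :
    Continuous (𝓕⁻ f) := by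
  have : 𝓕⁻ f = fun x => 𝓕 f (-x) := funext fun x => Real.fourierInv_eq_fourier_neg f x
  rw [this]
  exact (continuous_fourier_of_integrable hf).comp continuous_neg

/-- The hypothesis says that `g` is the Fourier transform of `f` as a tempered distribution. Taking
for `ψ` the inverse transform of a test function and moving the transform onto `g` identifies `f`
with `𝓕⁻ g`. -/
theorem ae_eq_fourierInv_of_integral_eq {f g : E → ℂ} (hf : LocallyIntegrable f volume)
    (hg : Integrable g) (h : ∀ ψ : 𝓢(E, ℂ), ∫ x, 𝓕 (ψ : E → ℂ) x * f x = ∫ x, ψ x * g x) :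
    ∀ᵐ x, f x = 𝓕⁻ g x := by
  refine ae_eq_of_integral_contDiff_smul_eq hf
    (continuous_fourierInv_of_integrable hg).locallyIntegrable fun φ hφ hφc => ?_
  have hφ₁ : HasCompactSupport (Complex.ofRealCLM ∘ φ) := hφc.comp_left rfl
  have hφ₂ : ContDiff ℝ ∞ (Complex.ofRealCLM ∘ φ) := by fun_prop
  set Φ : 𝓢(E, ℂ) := hφ₁.toSchwartzMap hφ₂ with hΦ
  have hΦx : ∀ x, Φ x = φ x := fun x => rfl
  have h1 := h (𝓕⁻ Φ)
  have h2 : 𝓕 ((𝓕⁻ Φ : 𝓢(E, ℂ)) : E → ℂ) = Φ := by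
    rw [← SchwartzMap.fourier_coe, FourierTransform.fourier_fourierInv_eq]
  have h3 : ((𝓕⁻ Φ : 𝓢(E, ℂ)) : E → ℂ) = fun x => 𝓕 (Φ : E → ℂ) (-x) := by
    rw [SchwartzMap.fourierInv_coe]
    exact funext fun x => Real.fourierInv_eq_fourier_neg _ x
  rw [h2, h3] at h1
  have h4 : ∫ x, 𝓕 (Φ : E → ℂ) (-x) * g x = ∫ x, Φ x * 𝓕⁻ g x := by
    rw [← integral_neg_eq_self]
    simp only [neg_neg]
    rw [integral_fourier_mul_eq Φ.integrable hg.comp_neg, Real.fourierInv_eq_fourier_comp_neg]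
  rw [h4] at h1
  simpa [hΦx] using h1

theorem ae_eq_fourierInv_fourier {f : E → ℂ} (hf : Integrable f) (hf' : Integrable (𝓕 f)) :
    ∀ᵐ x, f x = 𝓕⁻ (𝓕 f) x :=
  ae_eq_fourierInv_of_integral_eq hf.locallyIntegrable hf' fun ψ =>
    integral_fourier_mul_eq ψ.integrable hf

end Fourier

/-! ### The angular-frequency normalisation, and Fourier representation of Sobolev functions -/

section FourierV

variable {d : ℕ}

/-- The Fourier integral without a normalizing constant. -/
def fourierInt (f : Space d → ℂ) (η : Space d) : ℂ :=
  ∫ v : Space d, f v * Complex.exp (-(Complex.I * ((inner ℝ v η : ℝ) : ℂ)))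

theorem fourierInt_eq (f : Space d → ℂ) (η : Space d) :
    fourierInt f η = 𝓕 f ((2 * Real.pi)⁻¹ • η) := by
  rw [fourierInt, Real.fourier_eq']
  refine integral_congr_ae (Eventually.of_forall fun v => ?_)
  simp only [smul_eq_mul, inner_smul_right]
  rw [mul_comm]
  congr 2
  have : (Real.pi : ℂ) ≠ 0 := by exact_mod_cast Real.pi_ne_zero
  push_cast
  field_simp

theorem fourierV_eq (f : Space d → ℂ) (η : Space d) :
    fourierV f η = (((2 * Real.pi) ^ (-(d : ℝ) / 2) : ℝ) : ℂ) * fourierInt f η := rfl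

theorem continuous_fourierInt {f : Space d → ℂ} (hf : Integrable f) :
    Continuous (fourierInt f) := by
  have : fourierInt f = fun η => 𝓕 f ((2 * Real.pi)⁻¹ • η) := funext (fourierInt_eq f)
  rw [this]
  exact (continuous_fourier_of_integrable hf).comp (continuous_const_smul _)

/-- The substitution `η = 2πξ` has Jacobian `(2π)^d`, which cancels the two factors `(2π)^{-d/2}`.
-/
theorem fourierVInv_fourierV_eq (f : Space d → ℂ) (v : Space d) :
    fourierVInv (fourierV f) v = 𝓕⁻ (𝓕 f) v := by
  have hpi : (0 : ℝ) < 2 * Real.pi := by positivity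
  set c : ℝ := (2 * Real.pi) ^ (-(d : ℝ) / 2) with hc
  have hcc : c * c * (2 * Real.pi) ^ d = 1 := by
    rw [hc, ← Real.rpow_add hpi, ← Real.rpow_natCast, ← Real.rpow_add hpi]
    ring_nf; simp
  have h := Measure.integral_comp_inv_smul (volume : Measure (Space d))
    (fun ξ => 𝓕 f ξ * Complex.exp (Complex.I * ((inner ℝ v ((2 * Real.pi) • ξ) : ℝ) : ℂ)))
    (2 * Real.pi)
  simp only [smul_inv_smul₀ hpi.ne', finrank_euclideanSpace_fin, abs_of_pos (pow_pos hpi d)] at h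
  rw [fourierVInv]
  simp only [fourierV_eq, fourierInt_eq, mul_assoc, integral_const_mul]
  rw [h, Complex.real_smul, ← hc, ← mul_assoc, ← mul_assoc]
  have h2 : (c : ℂ) * (c : ℂ) * (((2 * Real.pi) ^ d : ℝ) : ℂ) = 1 := by
    exact_mod_cast hcc
  rw [h2, one_mul, Real.fourierInv_eq']
  refine integral_congr_ae (Eventually.of_forall fun ξ => ?_)
  simp only [smul_eq_mul, inner_smul_right]
  rw [mul_comm, real_inner_comm]
  congr 2
  push_cast
  ring

theorem fourierVInv_fourierV_ae {f : Space d → ℂ} (hf : Integrable f)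
    (hf' : Integrable (fourierV f)) : ∀ᵐ v, fourierVInv (fourierV f) v = f v := by
  have hpi : (0 : ℝ) < 2 * Real.pi := by positivity
  have h1 : Integrable (fourierInt f) := by
    have h2 := hf'.const_mul (((2 * Real.pi) ^ (-(d : ℝ) / 2) : ℝ) : ℂ)⁻¹
    refine h2.congr (Eventually.of_forall fun η => ?_)
    simp only [fourierV_eq]
    rw [inv_mul_cancel_left₀]
    exact_mod_cast (Real.rpow_pos_of_pos hpi _).ne'
  have h2 : Integrable (𝓕 f) := by
    rw [← integrable_comp_smul_iff volume _ (inv_ne_zero hpi.ne')]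
    exact h1.congr (Eventually.of_forall (fourierInt_eq f))
  filter_upwards [ae_eq_fourierInv_fourier hf h2] with v hv
  rw [fourierVInv_fourierV_eq, ← hv]

theorem fourierInt_conv {K w : Space d → ℝ} (hK : Integrable K) (hw : Integrable w)
    (η : Space d) : fourierInt (fun v => ((K ⋆[mul ℝ ℝ] w) v : ℂ)) η =
      fourierInt (fun v => (K v : ℂ)) η * fourierInt (fun v => (w v : ℂ)) η := by
  have h : (fun v => ((K ⋆[mul ℝ ℝ] w) v : ℂ)) =
      (fun v => (K v : ℂ)) ⋆[mul ℂ ℂ] fun v => (w v : ℂ) := by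
    funext v
    simp only [convolution_def, mul_apply', ← integral_complex_ofReal, Complex.ofReal_mul]
  rw [h, fourierInt_eq, fourierInt_eq, fourierInt_eq]
  exact Real.fourier_mul_convolution_eq (R := ℂ) hK.ofReal hw.ofReal _

/-- A function in a Sobolev space is the inverse Fourier transform of a function in a weighted
`L²` space. -/
theorem MemH.exists_fourierInv {s k : ℕ} (hks : k ≤ s) (hk : d < 2 * k) {V : Space d → ℝ}
    (hV : MemH s V) : ∃ G : Space d → ℂ, MemLp G 2 volume ∧
      MemLp (fun ξ => ((‖ξ‖ ^ k : ℝ) : ℂ) * G ξ) 2 volume ∧ Integrable G ∧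
      ∀ᵐ y, (V y : ℂ) = 𝓕⁻ G y := by
  obtain ⟨hV2, hS⟩ := hV
  obtain ⟨u, hu⟩ := TemperedDistribution.memSobolev_iff_exists_smulLeftCLM_fourier.1
    (hS.mono (Nat.cast_le.2 hks))
  -- `a` is the Bessel weight of order `k` and `b` its reciprocal; `u` represents `a · 𝓕V` in `L²`,
  -- so `G = b u`. Both `b` and `|x|^k b` are at most 1, which gives the two `L²` bounds.
  set a : Space d → ℝ := fun x => (1 + ‖x‖ ^ 2) ^ ((k : ℝ) / 2) with ha
  set b : Space d → ℝ := fun x => (1 + ‖x‖ ^ 2) ^ (-(k : ℝ) / 2) with hb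
  have hag : (fun x => (a x : ℂ)).HasTemperateGrowth := by fun_prop
  have hbg : (fun x => (b x : ℂ)).HasTemperateGrowth := by fun_prop
  have hab : ∀ x, a x * b x = 1 := fun x => by
    rw [ha, hb, ← Real.rpow_add (by positivity)]
    ring_nf; simp
  have hb0 : ∀ x, 0 ≤ b x := fun x => by positivity
  have ha1 : ∀ x, 1 ≤ a x := fun x => Real.one_le_rpow (by nlinarith [sq_nonneg ‖x‖]) (by positivity)
  have hb1 : ∀ x, b x ≤ 1 := fun x => by nlinarith [hab x, hb0 x, ha1 x]
  have hxa : ∀ x, ‖x‖ ^ k ≤ a x := fun x => by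
    rw [ha]
    calc ‖x‖ ^ k = (‖x‖ ^ (2 : ℕ)) ^ ((k : ℝ) / 2) := by
          rw [← Real.rpow_natCast, ← Real.rpow_natCast, ← Real.rpow_mul (norm_nonneg x)]
          congr 1; push_cast; ring
      _ ≤ _ := Real.rpow_le_rpow (by positivity) (by linarith) (by positivity)
  have hxb : ∀ x, ‖x‖ ^ k * b x ≤ 1 := fun x => by
    rw [← hab x]; exact mul_le_mul_of_nonneg_right (hxa x) (hb0 x)
  have hbc : Continuous fun x => (b x : ℂ) := hbg.1.continuous
  have hum := Lp.memLp u
  have hG2 : MemLp (fun x => (b x : ℂ) * u x) 2 volume := by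
    refine hum.mono (hbc.aestronglyMeasurable.mul hum.1) (Eventually.of_forall fun x => ?_)
    rw [norm_mul, Complex.norm_real, Real.norm_of_nonneg (hb0 x)]
    exact mul_le_of_le_one_left (norm_nonneg _) (hb1 x)
  have hGw : MemLp (fun x => ((‖x‖ ^ k : ℝ) : ℂ) * ((b x : ℂ) * u x)) 2 volume := by
    have hc : Continuous fun x : Space d => ((‖x‖ ^ k : ℝ) : ℂ) := by fun_prop
    refine hum.mono (hc.aestronglyMeasurable.mul hG2.1) (Eventually.of_forall fun x => ?_)
    rw [norm_mul, norm_mul, Complex.norm_real, Complex.norm_real, Real.norm_of_nonneg (hb0 x),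
      Real.norm_of_nonneg (by positivity), ← mul_assoc]
    exact mul_le_of_le_one_left (norm_nonneg _) (hxb x)
  have hG1 : Integrable fun x => (b x : ℂ) * u x := by
    refine (integrable_norm_iff hG2.1).1
      (integrable_of_memLp_weight hk hG2.norm ?_ le_rfl).1
    refine hGw.norm.ae_eq (Eventually.of_forall fun x => ?_)
    simp only
    rw [norm_mul, Complex.norm_real, Real.norm_of_nonneg (by positivity)]
  refine ⟨fun x => (b x : ℂ) * u x, hG2, hGw, hG1, ?_⟩
  refine ae_eq_fourierInv_of_integral_eq (hV2.locallyIntegrable (by norm_num)) hG1 fun ψ => ?_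
  have h1 : ∫ x, 𝓕 (ψ : Space d → ℂ) x * (V x : ℂ) =
      (Lp.toTemperedDistribution hV2.toLp) (𝓕 ψ) := by
    rw [Lp.toTemperedDistribution_apply]
    refine integral_congr_ae ?_
    filter_upwards [hV2.coeFn_toLp] with x hx
    rw [hx, SchwartzMap.fourier_coe, smul_eq_mul]
  have h2 : SchwartzMap.smulLeftCLM ℂ (fun x => (a x : ℂ))
      (SchwartzMap.smulLeftCLM ℂ (fun x => (b x : ℂ)) ψ) = ψ := by
    ext x
    rw [SchwartzMap.smulLeftCLM_apply_apply hag, SchwartzMap.smulLeftCLM_apply_apply hbg,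
      smul_eq_mul, smul_eq_mul, ← mul_assoc, ← Complex.ofReal_mul, hab, Complex.ofReal_one, one_mul]
  rw [h1, ← TemperedDistribution.fourier_apply]
  -- Writing `ψ = a (b ψ)` lets the factor `a` pass to `𝓕V`, where it produces `u`.
  conv_lhs => rw [← h2]
  rw [← TemperedDistribution.smulLeftCLM_apply_apply]
  have h3 := congrArg (fun T => T (SchwartzMap.smulLeftCLM ℂ (fun x => (b x : ℂ)) ψ)) hu
  refine h3.trans ?_
  rw [Lp.toTemperedDistribution_apply]
  refine integral_congr_ae (Eventually.of_forall fun x => ?_)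
  simp only
  rw [SchwartzMap.smulLeftCLM_apply_apply hbg, smul_eq_mul, smul_eq_mul]
  ring

end FourierV

/-! ### The potential operator as a convolution -/

section Potential

variable {d k : ℕ}

theorem memLp_comp_smul {f : Space d → ℝ} (hf : MemLp f 2 volume) {R : ℝ} (hR : R ≠ 0) :
    MemLp (fun v => f (R • v)) 2 volume := by
  refine (memLp_two_iff_integrable_sq (hf.1.comp_quasiMeasurePreserving
    ⟨measurable_const_smul R, ?_⟩)).2 (hf.integrable_sq.comp_smul hR)
  rw [Measure.map_addHaar_smul _ hR]
  exact Measure.smul_absolutelyContinuous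

theorem ae_comp_add_smul {p : Space d → Prop} (hp : ∀ᵐ y : Space d, p y) (x : Space d) {c : ℝ}
    (hc : c ≠ 0) : ∀ᵐ η : Space d, p (x + c • η) := by
  have h1 : ∀ᵐ y : Space d, p (x + y) :=
    (measurePreserving_add_left volume x).quasiMeasurePreserving.ae hp
  have h2 : Measure.QuasiMeasurePreserving (fun v : Space d => c • v) volume volume := by
    refine ⟨measurable_const_smul c, ?_⟩
    rw [Measure.map_addHaar_smul _ hc]
    exact Measure.smul_absolutelyContinuous
  exact h2.ae h1

theorem integrable_mul_cexp {f : Space d → ℂ} (hf : Integrable f) {t : Space d → ℝ}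
    (ht : Continuous t) : Integrable fun v => f v * Complex.exp (Complex.I * (t v : ℂ)) := by
  refine hf.mono (hf.1.mul (by fun_prop : Continuous fun v =>
    Complex.exp (Complex.I * (t v : ℂ))).aestronglyMeasurable) (Eventually.of_forall fun v => ?_)
  rw [norm_mul, mul_comm Complex.I, Complex.norm_exp_ofReal_mul_I, mul_one]

/-- The symbol `i δV(x, ·)` is the Fourier integral of a real odd function in the weighted space. -/
theorem MemH.exists_kernel {s : ℕ} (hks : k ≤ s) (hk : d < 2 * k) {V : Space d → ℝ}
    (hV : MemH s V) {hbar m : ℝ} (hhbar : 0 < hbar) (hm : 0 < m) (x : Space d) :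
    ∃ K : Space d → ℝ, MemLp K 2 (weightedMeasure d k) ∧ (∀ t, K (-t) = -K t) ∧
      ∀ᵐ η : Space d, Complex.I * (deltaV hbar m V x η : ℂ) =
        fourierInt (fun v => (K v : ℂ)) η := by
  obtain ⟨G, hG2, hGw, hG1, hVG⟩ := hV.exists_fourierInv hks hk
  set c : ℝ := hbar / (2 * m) with hc
  have hc0 : 0 < c := by positivity
  set R : ℝ := 2 * Real.pi * c with hR
  have hR0 : 0 < R := by positivity
  -- The translation by `x` becomes a phase, so that `V(x ± cη) = ∫ z(ξ) e^{± iR ξ·η} dξ` with `R =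
  -- 2πc`.
  set z : Space d → ℂ := fun ξ => G ξ * Complex.exp (Complex.I * ((2 * Real.pi * inner ℝ ξ x : ℝ) : ℂ))
    with hz
  have hz1 : Integrable z := integrable_mul_cexp hG1 (by fun_prop)
  have hzn : ∀ ξ, ‖z ξ‖ = ‖G ξ‖ := fun ξ => by
    rw [hz]; simp only
    rw [norm_mul, mul_comm Complex.I, Complex.norm_exp_ofReal_mul_I, mul_one]
  set A : Space d → ℝ := fun ξ => (z ξ).im with hA
  have hA1 : Integrable A := hz1.im
  have hAn : ∀ ξ, ‖A ξ‖ ≤ ‖G ξ‖ := fun ξ => by rw [← hzn]; exact Complex.abs_im_le_norm _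
  have hA2 : MemLp A 2 volume := hG2.mono hA1.1 (Eventually.of_forall hAn)
  have hAw : MemLp (fun ξ => ‖ξ‖ ^ k * A ξ) 2 volume := by
    have hcont : Continuous fun ξ : Space d => ‖ξ‖ ^ k := by fun_prop
    refine hGw.mono (hcont.aestronglyMeasurable.mul hA1.1) (Eventually.of_forall fun ξ => ?_)
    rw [norm_mul, norm_mul, Complex.norm_real]
    gcongr
    exact hAn ξ
  -- Passing from `V(x + cη)` to `V(x - cη)` reflects `ξ`; their difference therefore sees only the
  -- odd part of `A = Im z`.
  set J : Space d → ℝ := fun ξ => A ξ - A (-ξ) with hJ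
  have hJ2 : MemLp J 2 volume :=
    hA2.sub (hA2.comp_measurePreserving (Measure.measurePreserving_neg volume))
  have hJw : MemLp (fun ξ => ‖ξ‖ ^ k * J ξ) 2 volume := by
    refine (hAw.sub (hAw.comp_measurePreserving (Measure.measurePreserving_neg volume))).ae_eq
      (Eventually.of_forall fun ξ => ?_)
    simp only [Pi.sub_apply, Function.comp_apply, norm_neg, hJ]
    ring
  -- `1/ħ` comes from `δV`, and `R^{-d}` compensates the Jacobian of the dilation `u = Rξ`.
  set a : ℝ := 1 / hbar * (R ^ d)⁻¹ with ha
  refine ⟨fun u => a * J (R⁻¹ • u), ?_, fun t => ?_, ?_⟩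
  · rw [memLp_weightedMeasure]
    refine ⟨(memLp_comp_smul hJ2 (inv_ne_zero hR0.ne')).const_mul a, ?_⟩
    refine ((memLp_comp_smul hJw (inv_ne_zero hR0.ne')).const_mul (a * R ^ k)).ae_eq
      (Eventually.of_forall fun v => ?_)
    have hRk : R ^ k * R⁻¹ ^ k = 1 := by rw [← mul_pow, mul_inv_cancel₀ hR0.ne', one_pow]
    simp only [norm_smul, norm_inv, Real.norm_of_nonneg hR0.le, mul_pow]
    linear_combination (a * ‖v‖ ^ k * J (R⁻¹ • v)) * hRk
  · simp only [hJ, smul_neg, neg_neg]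
    ring
  · filter_upwards [ae_comp_add_smul hVG x hc0.ne', ae_comp_add_smul hVG x (neg_ne_zero.2 hc0.ne')]
      with η h1 h2
    set e : Space d → ℂ := fun ξ => Complex.exp (Complex.I * ((R * inner ℝ ξ η : ℝ) : ℂ)) with he
    set e' : Space d → ℂ := fun ξ => Complex.exp (Complex.I * ((-(R * inner ℝ ξ η) : ℝ) : ℂ))
      with he'
    have hconj : ∀ ξ, (starRingEnd ℂ) (e ξ) = e' ξ := fun ξ => by
      rw [he, he']; simp only
      rw [← Complex.exp_conj, map_mul, Complex.conj_I, Complex.conj_ofReal]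
      congr 1; push_cast; ring
    have hconj' : ∀ ξ, (starRingEnd ℂ) (e' ξ) = e ξ := fun ξ => by
      rw [← hconj, Complex.conj_conj]
    have hneg : ∀ ξ, e (-ξ) = e' ξ := fun ξ => by
      rw [he, he']; simp only [inner_neg_left, mul_neg]
    have v1 : (V (x + c • η) : ℂ) = ∫ ξ, z ξ * e ξ := by
      rw [h1, Real.fourierInv_eq']
      refine integral_congr_ae (Eventually.of_forall fun ξ => ?_)
      simp only [hz, he]
      rw [smul_eq_mul, mul_assoc (G ξ), ← Complex.exp_add, mul_comm (G ξ), inner_add_right, inner_smul_right]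
      congr 2
      rw [hR]; push_cast; ring
    have v2 : (V (x - c • η) : ℂ) = ∫ ξ, z ξ * e' ξ := by
      rw [sub_eq_add_neg, ← neg_smul, h2, Real.fourierInv_eq']
      refine integral_congr_ae (Eventually.of_forall fun ξ => ?_)
      simp only [hz, he']
      rw [smul_eq_mul, mul_assoc (G ξ), ← Complex.exp_add, mul_comm (G ξ), inner_add_right, inner_smul_right]
      congr 2
      rw [hR]; push_cast; ring
    -- `V` is real, so conjugation gives second representations. Subtracting across the two kinds
    -- leaves `z - z̄ = 2iA`, hence a real kernel.
    have v1' : (V (x + c • η) : ℂ) = ∫ ξ, (starRingEnd ℂ) (z ξ) * e' ξ := by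
      rw [← Complex.conj_ofReal, v1, ← integral_conj]
      simp only [map_mul, hconj]
    have v2' : (V (x - c • η) : ℂ) = ∫ ξ, (starRingEnd ℂ) (z ξ) * e ξ := by
      rw [← Complex.conj_ofReal, v2, ← integral_conj]
      simp only [map_mul, hconj']
    have hzc : Integrable fun ξ => (starRingEnd ℂ) (z ξ) := by
      refine hz1.mono (Complex.continuous_conj.comp_aestronglyMeasurable hz1.1)
        (Eventually.of_forall fun ξ => by simp)
    have hce : Continuous fun ξ : Space d => R * inner ℝ ξ η := by fun_prop
    have i1 : Integrable fun ξ => z ξ * e ξ := integrable_mul_cexp hz1 hce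
    have i2 : Integrable fun ξ => z ξ * e' ξ := integrable_mul_cexp hz1 hce.neg
    have i3 : Integrable fun ξ => (starRingEnd ℂ) (z ξ) * e' ξ := integrable_mul_cexp hzc hce.neg
    have i4 : Integrable fun ξ => (starRingEnd ℂ) (z ξ) * e ξ := integrable_mul_cexp hzc hce
    have i5 : Integrable fun ξ => (A ξ : ℂ) * e ξ := integrable_mul_cexp hA1.ofReal hce
    have i6 : Integrable fun ξ => (A ξ : ℂ) * e' ξ := integrable_mul_cexp hA1.ofReal hce.neg
    have i7 : Integrable fun ξ => (A (-ξ) : ℂ) * e' ξ :=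
      integrable_mul_cexp hA1.ofReal.comp_neg hce.neg
    have hzA : ∀ ξ, z ξ - (starRingEnd ℂ) (z ξ) = 2 * Complex.I * (A ξ : ℂ) := fun ξ => by
      rw [Complex.sub_conj, hA]; push_cast; ring
    have d1 : (V (x + c • η) : ℂ) - V (x - c • η) = 2 * Complex.I * ∫ ξ, (A ξ : ℂ) * e ξ := by
      rw [v1, v2', ← integral_sub i1 i4, ← integral_const_mul]
      refine integral_congr_ae (Eventually.of_forall fun ξ => ?_)
      simp only
      rw [← sub_mul, hzA]; ring
    have d2 : (V (x - c • η) : ℂ) - V (x + c • η) = 2 * Complex.I * ∫ ξ, (A ξ : ℂ) * e' ξ := by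
      rw [v2, v1', ← integral_sub i2 i3, ← integral_const_mul]
      refine integral_congr_ae (Eventually.of_forall fun ξ => ?_)
      simp only
      rw [← sub_mul, hzA]; ring
    have d3 : ∫ ξ, (A ξ : ℂ) * e ξ = ∫ ξ, (A (-ξ) : ℂ) * e' ξ := by
      rw [← integral_neg_eq_self]
      simp only [hneg]
    have d4 : ∫ ξ, (J ξ : ℂ) * e' ξ =
        (∫ ξ, (A ξ : ℂ) * e' ξ) - ∫ ξ, (A (-ξ) : ℂ) * e' ξ := by
      rw [← integral_sub i6 i7]
      refine integral_congr_ae (Eventually.of_forall fun ξ => ?_)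
      simp only [hJ]
      push_cast; ring
    have hF : fourierInt (fun v => ((a * J (R⁻¹ • v) : ℝ) : ℂ)) η =
        (1 / hbar : ℂ) * ∫ ξ, (J ξ : ℂ) * e' ξ := by
      have h := Measure.integral_comp_inv_smul (volume : Measure (Space d))
        (fun ξ => (J ξ : ℂ) * Complex.exp (-(Complex.I * ((inner ℝ (R • ξ) η : ℝ) : ℂ)))) R
      simp only [smul_inv_smul₀ hR0.ne', finrank_euclideanSpace_fin, abs_of_pos (pow_pos hR0 d)] at h
      rw [fourierInt]
      simp only [Complex.ofReal_mul, mul_assoc, integral_const_mul]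
      rw [h, Complex.real_smul, ha]
      have hRc : ((R ^ d : ℝ) : ℂ) ≠ 0 := by exact_mod_cast (pow_pos hR0 d).ne'
      rw [Complex.ofReal_mul, Complex.ofReal_inv, mul_assoc, inv_mul_cancel_left₀ hRc,
        Complex.ofReal_div, Complex.ofReal_one]
      congr 1
      refine integral_congr_ae (Eventually.of_forall fun ξ => ?_)
      simp only [he', inner_smul_left, conj_trivial]
      congr 2
      push_cast; ring
    rw [hF, d4, ← d3]
    have hδ : (deltaV hbar m V x η : ℂ) =
        (1 / hbar : ℂ) * ((V (x + c • η) : ℂ) - V (x - c • η)) := by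
      rw [deltaV]; push_cast; ring
    rw [hδ]
    linear_combination (1 / hbar : ℂ) * ((1 / 2 : ℂ) * Complex.I * d1
      - (1 / 2 : ℂ) * Complex.I * d2)
      + (1 / hbar : ℂ) * ((∫ ξ, (A ξ : ℂ) * e ξ) - ∫ ξ, (A ξ : ℂ) * e' ξ) * Complex.I_sq

/-- The Fourier transform of a function in `L¹ ∩ L²` belongs to `L²`. -/
theorem memLp_fourier_of_integrable {f : Space d → ℂ} (hf1 : Integrable f)
    (hf2 : MemLp f 2 volume) : MemLp (𝓕 f) 2 volume := by
  -- The `L²` extension of the Fourier transform is identified with the Fourier integral by testing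
  -- against smooth compactly supported functions.
  have hF := Lp.memLp (𝓕 (hf2.toLp f))
  refine hF.ae_eq (ae_eq_of_integral_contDiff_smul_eq (hF.locallyIntegrable (by norm_num))
    (continuous_fourier_of_integrable hf1).locallyIntegrable fun φ hφ hφc => ?_)
  have hφ₁ : HasCompactSupport (Complex.ofRealCLM ∘ φ) := hφc.comp_left rfl
  have hφ₂ : ContDiff ℝ ∞ (Complex.ofRealCLM ∘ φ) := by fun_prop
  set Φ : 𝓢(Space d, ℂ) := hφ₁.toSchwartzMap hφ₂ with hΦ
  have hΦx : ∀ x, Φ x = φ x := fun x => rfl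
  have h1 := Lp.toTemperedDistribution_apply (𝓕 (hf2.toLp f)) Φ
  rw [← Lp.fourier_toTemperedDistribution_eq, TemperedDistribution.fourier_apply,
    Lp.toTemperedDistribution_apply] at h1
  have h2 := integral_fourier_mul_eq Φ.integrable hf1
  have h3 : ∫ x, (𝓕 Φ) x • hf2.toLp f x = ∫ x, 𝓕 (Φ : Space d → ℂ) x * f x := by
    refine integral_congr_ae ?_
    filter_upwards [hf2.coeFn_toLp] with x hx
    rw [hx, SchwartzMap.fourier_coe, smul_eq_mul]
  rw [h3, h2] at h1
  simpa [hΦx] using h1.symm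

/-! ### Identification of `Θ[V]` with the convolution operator -/

theorem memLp_fourierInt {f : Space d → ℂ} (hf1 : Integrable f) (hf2 : MemLp f 2 volume) :
    MemLp (fourierInt f) 2 volume := by
  have h := memLp_fourier_of_integrable hf1 hf2
  have hc := continuous_fourierInt hf1
  refine (memLp_two_iff_integrable_sq_norm hc.aestronglyMeasurable).2 ?_
  have hi := (memLp_two_iff_integrable_sq_norm h.1).1 h
  refine (hi.comp_smul (inv_ne_zero (by positivity : (2 * Real.pi) ≠ 0))).congr
    (Eventually.of_forall fun η => ?_)
  simp only [fourierInt_eq]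

theorem fourierV_conv {K w : Space d → ℝ} (hK : Integrable K) (hw : Integrable w)
    (η : Space d) : fourierV (fun v => ((K ⋆[mul ℝ ℝ] w) v : ℂ)) η =
      fourierInt (fun v => (K v : ℂ)) η * fourierV (fun v => (w v : ℂ)) η := by
  rw [fourierV_eq, fourierV_eq, fourierInt_conv hK hw]; ring

/-- The transform is a product of two `L²` functions, hence integrable; this makes the inversion
integral of `K ⋆ w` absolutely convergent. -/
theorem integrable_fourierV_conv {K w : Space d → ℝ} (hK : Integrable K) (hK2 : MemLp K 2 volume)
    (hw : Integrable w) (hw2 : MemLp w 2 volume) :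
    Integrable (fourierV fun v => ((K ⋆[mul ℝ ℝ] w) v : ℂ)) := by
  have h := ((memLp_fourierInt hK.ofReal hK2.ofReal).integrable_mul
    (memLp_fourierInt hw.ofReal hw2.ofReal)).const_mul
      (((2 * Real.pi) ^ (-(d : ℝ) / 2) : ℝ) : ℂ)
  refine h.congr (Eventually.of_forall fun η => ?_)
  rw [fourierV_eq, fourierInt_conv hK hw]
  rfl

theorem fourierVInv_congr_ae {f g : Space d → ℂ} (h : ∀ᵐ η, f η = g η) :
    fourierVInv f = fourierVInv g := by
  funext v
  rw [fourierVInv, fourierVInv]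
  congr 1
  refine integral_congr_ae ?_
  filter_upwards [h] with η hη
  rw [hη]

theorem Theta_ae_eq_conv {hbar m : ℝ} {V : Space d → ℝ} {x : Space d} {K w : Space d → ℝ}
    (hδ : ∀ᵐ η : Space d, Complex.I * (deltaV hbar m V x η : ℂ) =
      fourierInt (fun v => (K v : ℂ)) η) (hK : Integrable K) (hK2 : MemLp K 2 volume)
    (hw : Integrable w) (hw2 : MemLp w 2 volume) :
    ∀ᵐ v, Theta hbar m V x w v = ((K ⋆[mul ℝ ℝ] w) v : ℂ) := by
  have h : Theta hbar m V x w = fourierVInv (fourierV fun v => ((K ⋆[mul ℝ ℝ] w) v : ℂ)) := by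
    refine fourierVInv_congr_ae ?_
    filter_upwards [hδ] with η hη
    rw [hη, fourierV_conv hK hw]
  rw [h]
  exact fourierVInv_fourierV_ae (hK.integrable_convolution (mul ℝ ℝ) hw).ofReal
    (integrable_fourierV_conv hK hK2 hw hw2)

end Potential

/-! ### Gaussian moments -/

section Gaussian

variable {d k : ℕ}

theorem integrable_mul_gaussian {p : Space d → ℝ} (hp : p.HasTemperateGrowth) {b : ℝ}
    (hb : 0 < b) : Integrable fun v => p v * Real.exp (-(b * ‖v‖ ^ 2)) := by
  obtain ⟨n, C, hC⟩ := hp.2 0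
  have hC' : ∀ v, |p v| ≤ C * (1 + ‖v‖) ^ n := fun v => by simpa using hC v
  have hC0 : 0 ≤ C := by
    have := (abs_nonneg _).trans (hC' 0)
    simpa using this
  have hg : Integrable fun v : Space d => Real.exp (-(b / 2 * ‖v‖ ^ 2)) := by
    have h := (GaussianFourier.integrable_cexp_neg_mul_sq_norm_add (V := Space d)
      (b := ((b / 2 : ℝ) : ℂ)) (by simpa using hb) 0 0).norm
    refine h.congr (Eventually.of_forall fun v => ?_)
    simp only [zero_mul, add_zero]
    rw [Complex.norm_exp]
    congr 1
    norm_cast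
    simp
  -- With `1 + |v| ≤ D e^{δ|v|²}` and `nδ ≤ b/2`, growth of order `n` consumes at most half of the
  -- Gaussian exponent.
  set δ : ℝ := b / (2 * (n + 1)) with hδ
  have hδ0 : 0 < δ := by positivity
  have hnδ : n * δ ≤ b / 2 := by
    rw [hδ, mul_div_assoc', div_le_div_iff₀ (by positivity) (by norm_num)]
    nlinarith
  set D : ℝ := 1 + 1 / (4 * δ) with hD
  have hone : ∀ v : Space d, 1 + ‖v‖ ≤ D * Real.exp (δ * ‖v‖ ^ 2) := fun v => by
    have h1 : 1 + δ * ‖v‖ ^ 2 ≤ Real.exp (δ * ‖v‖ ^ 2) := by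
      linarith [Real.add_one_le_exp (δ * ‖v‖ ^ 2)]
    have h2 : ‖v‖ ≤ 1 / (4 * δ) + δ * ‖v‖ ^ 2 := by
      rw [← sub_nonneg]
      have : 1 / (4 * δ) + δ * ‖v‖ ^ 2 - ‖v‖ = (2 * δ * ‖v‖ - 1) ^ 2 / (4 * δ) := by
        field_simp; ring
      rw [this]; positivity
    have h3 : 0 ≤ 1 / (4 * δ) * (δ * ‖v‖ ^ 2) := by positivity
    calc 1 + ‖v‖ ≤ D * (1 + δ * ‖v‖ ^ 2) := by rw [hD]; nlinarith
      _ ≤ _ := by gcongr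
  refine (hg.const_mul (C * D ^ n)).mono ((hp.1.continuous.mul (by fun_prop)).aestronglyMeasurable)
    (Eventually.of_forall fun v => ?_)
  rw [norm_mul, Real.norm_eq_abs, Real.norm_of_nonneg (Real.exp_pos _).le,
    Real.norm_of_nonneg (by positivity)]
  calc |p v| * Real.exp (-(b * ‖v‖ ^ 2))
      ≤ C * (D * Real.exp (δ * ‖v‖ ^ 2)) ^ n * Real.exp (-(b * ‖v‖ ^ 2)) := by
        gcongr
        exact (hC' v).trans (by gcongr; exact hone v)
    _ = C * D ^ n * Real.exp (n * δ * ‖v‖ ^ 2 - b * ‖v‖ ^ 2) := by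
        rw [mul_pow, ← Real.exp_nat_mul, sub_eq_add_neg, Real.exp_add]; ring_nf
    _ ≤ _ := by
        gcongr
        nlinarith [mul_le_mul_of_nonneg_right hnδ (sq_nonneg ‖v‖)]

theorem hasTemperateGrowth_inner (e : Space d) :
    (fun v : Space d => inner ℝ v e).HasTemperateGrowth := by
  have : (fun v : Space d => inner ℝ v e) = innerSL ℝ e := by
    funext v; rw [innerSL_apply_apply, real_inner_comm]
  rw [this]
  exact (innerSL ℝ e).hasTemperateGrowth

theorem integrable_mul_gaussian_mul_cexp {p : Space d → ℝ} (hp : p.HasTemperateGrowth) {b : ℝ}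
    (hb : 0 < b) (η : Space d) : Integrable fun v => ((p v * Real.exp (-(b * ‖v‖ ^ 2)) : ℝ) : ℂ) *
      Complex.exp (-(Complex.I * ((inner ℝ v η : ℝ) : ℂ))) := by
  refine (integrable_mul_cexp (integrable_mul_gaussian hp hb).ofReal
    (t := fun v => -inner ℝ v η) (by fun_prop)).congr (Eventually.of_forall fun v => ?_)
  simp

theorem hasLineDerivAt_gaussian_mul_cexp (b : ℝ) (η e v : Space d) :
    HasLineDerivAt ℝ (fun v => (Real.exp (-(b * ‖v‖ ^ 2)) : ℂ) *
      Complex.exp (-(Complex.I * ((inner ℝ v η : ℝ) : ℂ))))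
      ((-(2 * b * inner ℝ v e : ℝ) - Complex.I * (inner ℝ e η : ℝ)) *
        ((Real.exp (-(b * ‖v‖ ^ 2)) : ℂ) *
          Complex.exp (-(Complex.I * ((inner ℝ v η : ℝ) : ℂ))))) v e := by
  have hcomb : ∀ u : Space d, (Real.exp (-(b * ‖u‖ ^ 2)) : ℂ) *
      Complex.exp (-(Complex.I * ((inner ℝ u η : ℝ) : ℂ))) =
      Complex.exp (((-(b * ‖u‖ ^ 2) : ℝ) : ℂ) - Complex.I * ((inner ℝ u η : ℝ) : ℂ)) := fun u => by
    rw [Complex.ofReal_exp, ← Complex.exp_add, sub_eq_add_neg]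
  simp only [hcomb]
  rw [HasLineDerivAt]
  have hn : ∀ t : ℝ, ‖v + t • e‖ ^ 2 = ‖v‖ ^ 2 + t * (2 * inner ℝ v e) + t ^ 2 * ‖e‖ ^ 2 := by
    intro t
    rw [norm_add_sq_real, inner_smul_right, norm_smul, mul_pow, Real.norm_eq_abs, sq_abs]; ring
  simp only [hn, inner_add_left, inner_smul_left, conj_trivial]
  have h1 : HasDerivAt (fun t : ℝ => -(b * (‖v‖ ^ 2 + t * (2 * inner ℝ v e) + t ^ 2 * ‖e‖ ^ 2)))
      (-(2 * b * inner ℝ v e)) 0 := by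
    have := ((((hasDerivAt_id (0 : ℝ)).mul_const (2 * inner ℝ v e)).const_add (‖v‖ ^ 2)).add
      (((hasDerivAt_id (0 : ℝ)).pow 2).mul_const (‖e‖ ^ 2))).const_mul b |>.neg
    refine (this.congr_deriv ?_)
    simp; ring
  have h2 : HasDerivAt (fun t : ℝ => inner ℝ v η + t * inner ℝ e η) (inner ℝ e η) 0 := by
    simpa using ((hasDerivAt_id (0 : ℝ)).mul_const (inner ℝ e η)).const_add (inner ℝ v η)
  have h3 := (h1.ofReal_comp.sub (h2.ofReal_comp.const_mul Complex.I)).cexp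
  refine h3.congr_deriv ?_
  simp
  ring

/-- Integration by parts against a Gaussian with an oscillating factor. -/
theorem integral_inner_mul_gaussian {p : Space d → ℝ} {p' : ℝ} (hp : p.HasTemperateGrowth)
    {b : ℝ} (hb : 0 < b) (η e : Space d) (hp' : ∀ v, HasLineDerivAt ℝ p p' v e) :
    2 * (b : ℂ) * fourierInt
        (fun v => ((inner ℝ v e * p v * Real.exp (-(b * ‖v‖ ^ 2)) : ℝ) : ℂ)) η =
      p' * fourierInt (fun v => ((Real.exp (-(b * ‖v‖ ^ 2)) : ℝ) : ℂ)) η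
      - Complex.I * (inner ℝ η e : ℝ) *
        fourierInt (fun v => ((p v * Real.exp (-(b * ‖v‖ ^ 2)) : ℝ) : ℂ)) η := by
  have i0 := integrable_mul_gaussian_mul_cexp (Function.HasTemperateGrowth.const (1 : ℝ)) hb η
  have i1 := integrable_mul_gaussian_mul_cexp hp hb η
  have i2 := integrable_mul_gaussian_mul_cexp ((hasTemperateGrowth_inner e).mul hp) hb η
  simp only [Pi.mul_apply, one_mul] at i0 i2
  have e0 : ∀ v, ((p v : ℂ)) * ((-(2 * b * inner ℝ v e : ℝ) - Complex.I * (inner ℝ e η : ℝ)) *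
        ((Real.exp (-(b * ‖v‖ ^ 2)) : ℂ) *
          Complex.exp (-(Complex.I * ((inner ℝ v η : ℝ) : ℂ))))) =
      -(2 * (b : ℂ)) * (((inner ℝ v e * p v * Real.exp (-(b * ‖v‖ ^ 2)) : ℝ) : ℂ) *
        Complex.exp (-(Complex.I * ((inner ℝ v η : ℝ) : ℂ)))) -
      Complex.I * (inner ℝ η e : ℝ) * (((p v * Real.exp (-(b * ‖v‖ ^ 2)) : ℝ) : ℂ) *
        Complex.exp (-(Complex.I * ((inner ℝ v η : ℝ) : ℂ)))) := fun v => by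
    rw [real_inner_comm e η]; push_cast; ring
  have h := integral_bilinear_hasLineDerivAt_right_eq_neg_left_of_integrable
    (μ := (volume : Measure (Space d))) (B := ContinuousLinearMap.mul ℝ ℂ) (v := e)
    (f := fun v => (p v : ℂ)) (f' := fun _ => (p' : ℂ))
    (g := fun v => (Real.exp (-(b * ‖v‖ ^ 2)) : ℂ) *
      Complex.exp (-(Complex.I * ((inner ℝ v η : ℝ) : ℂ))))
    (g' := fun v => (-(2 * b * inner ℝ v e : ℝ) - Complex.I * (inner ℝ e η : ℝ)) *
        ((Real.exp (-(b * ‖v‖ ^ 2)) : ℂ) *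
          Complex.exp (-(Complex.I * ((inner ℝ v η : ℝ) : ℂ)))))
    (i0.const_mul _) ?_ ?_ (fun v _ => ?_)
    (fun v _ => hasLineDerivAt_gaussian_mul_cexp b η e v)
  · simp only [mul_apply', e0] at h
    rw [integral_sub (i2.const_mul _) (i1.const_mul _), integral_const_mul, integral_const_mul,
      integral_const_mul] at h
    simp only [fourierInt]
    linear_combination -h
  · simp only [mul_apply', e0]
    exact (i2.const_mul _).sub (i1.const_mul _)
  · refine i1.congr (Eventually.of_forall fun v => ?_)
    simp only [mul_apply']
    push_cast; ring
  · exact (hp' v).ofReal_comp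

/-- Two integrations by parts: along `f` with `p = 1` for the first moment, then along `e` with `p =
⟨·, f⟩`; the first moment is eliminated. -/
theorem fourierInt_second_moment {b : ℝ} (hb : 0 < b) (η e f : Space d) :
    fourierInt (fun v => ((inner ℝ v e * inner ℝ v f * Real.exp (-(b * ‖v‖ ^ 2)) : ℝ) : ℂ)) η =
      (((inner ℝ e f / (2 * b) - inner ℝ η e * inner ℝ η f / (4 * b ^ 2) : ℝ)) : ℂ) *
        fourierInt (fun v => ((Real.exp (-(b * ‖v‖ ^ 2)) : ℝ) : ℂ)) η := by
  have h1 := integral_inner_mul_gaussian (Function.HasTemperateGrowth.const (1 : ℝ)) (p' := 0)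
    hb η f (fun v => (hasDerivAt_const (0 : ℝ) (1 : ℝ)))
  have h2 := integral_inner_mul_gaussian (hasTemperateGrowth_inner f) (p' := inner ℝ e f) hb η e
    (fun v => by
      have : HasDerivAt (fun t : ℝ => inner ℝ v f + t * inner ℝ e f) (inner ℝ e f) 0 := by
        simpa using ((hasDerivAt_id (0 : ℝ)).mul_const (inner ℝ e f)).const_add (inner ℝ v f)
      simpa [HasLineDerivAt, inner_add_left, inner_smul_left] using this)
  simp only [mul_one, one_mul, Complex.ofReal_zero, zero_mul, zero_sub] at h1
  have hb' : (b : ℂ) ≠ 0 := by exact_mod_cast hb.ne'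
  set X := fourierInt (fun v => ((inner ℝ v e * inner ℝ v f * Real.exp (-(b * ‖v‖ ^ 2)) : ℝ) : ℂ)) η
  set Y := fourierInt (fun v => ((inner ℝ v f * Real.exp (-(b * ‖v‖ ^ 2)) : ℝ) : ℂ)) η
  set Z := fourierInt (fun v => ((Real.exp (-(b * ‖v‖ ^ 2)) : ℝ) : ℂ)) η
  push_cast
  field_simp
  linear_combination (4 * (b : ℂ)) * h2 - 2 * Complex.I * (inner ℝ η e : ℝ) * h1
    + 2 * (inner ℝ η e : ℝ) * (inner ℝ η f : ℝ) * Z * Complex.I_sq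

theorem fourierInt_gaussian {b : ℝ} (hb : 0 < b) (η : Space d) :
    fourierInt (fun v => ((Real.exp (-(b * ‖v‖ ^ 2)) : ℝ) : ℂ)) η =
      (((Real.pi / b) ^ ((d : ℝ) / 2) * Real.exp (-((4 * b)⁻¹ * ‖η‖ ^ 2)) : ℝ) : ℂ) := by
  have h := GaussianFourier.integral_cexp_neg_mul_sq_norm_add (V := Space d) (b := (b : ℂ))
    (by simpa using hb) (-Complex.I) η
  rw [fourierInt]
  convert h using 1
  · refine integral_congr_ae (Eventually.of_forall fun v => ?_)
    simp only
    rw [Complex.ofReal_exp, ← Complex.exp_add, real_inner_comm]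
    congr 1; push_cast; ring
  · rw [Complex.ofReal_mul, Complex.ofReal_cpow (by positivity), Complex.ofReal_exp]
    have hb' : (b : ℂ) ≠ 0 := by exact_mod_cast hb.ne'
    congr 2
    · push_cast; rfl
    · simp
    · push_cast
      rw [neg_sq, Complex.I_sq]
      field_simp

end Gaussian

/-! ### The local equilibrium -/

section Equilibrium

variable {d k : ℕ}

theorem integrable_fourierInt_integrand {f : Space d → ℂ} (hf : Integrable f) (η : Space d) :
    Integrable fun v => f v * Complex.exp (-(Complex.I * ((inner ℝ v η : ℝ) : ℂ))) := by
  refine (integrable_mul_cexp hf (t := fun v => -inner ℝ v η) (by fun_prop)).congr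
    (Eventually.of_forall fun v => ?_)
  simp

theorem fourierInt_add {f g : Space d → ℂ} (hf : Integrable f) (hg : Integrable g) (η : Space d) :
    fourierInt (fun v => f v + g v) η = fourierInt f η + fourierInt g η := by
  simp only [fourierInt, add_mul]
  exact integral_add (integrable_fourierInt_integrand hf η) (integrable_fourierInt_integrand hg η)

theorem fourierInt_sum {ι : Type*} (s : Finset ι) {f : ι → Space d → ℂ}
    (hf : ∀ i ∈ s, Integrable (f i)) (η : Space d) :
    fourierInt (fun v => ∑ i ∈ s, f i v) η = ∑ i ∈ s, fourierInt (f i) η := by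
  simp only [fourierInt, Finset.sum_mul]
  exact integral_finsetSum s fun i hi => integrable_fourierInt_integrand (hf i hi) η

theorem fourierInt_const_mul (a : ℂ) (f : Space d → ℂ) (η : Space d) :
    fourierInt (fun v => a * f v) η = a * fourierInt f η := by
  simp only [fourierInt, mul_assoc, integral_const_mul]

theorem fourierInt_congr_ae {f g : Space d → ℂ} (h : ∀ᵐ v, f v = g v) (η : Space d) :
    fourierInt f η = fourierInt g η := by
  refine integral_congr_ae ?_
  filter_upwards [h] with v hv
  rw [hv]

theorem fourierInt_zero (f : Space d → ℂ) : fourierInt f 0 = ∫ v, f v := by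
  simp [fourierInt]

theorem fourierVInv_const_mul (a : ℂ) (f : Space d → ℂ) (v : Space d) :
    fourierVInv (fun η => a * f η) v = a * fourierVInv f v := by
  simp only [fourierVInv, mul_assoc, integral_const_mul]
  ring

/-- The quadratic form of a matrix-valued function at a point. -/
def quadForm (H : Fin d → Fin d → Space d → ℝ) (x v : Space d) : ℝ :=
  ∑ r, ∑ s, v r * v s * H r s x

/-- The normalized quantum local equilibrium. -/
def equilibrium (hbar m β : ℝ) (H : Fin d → Fin d → Space d → ℝ) (x v : Space d) : ℝ :=
  maxwellian m β v * (1 + hbar ^ 2 * (β ^ 2 / 24) *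
    (-(1 / m) * ∑ r, H r r x + β * quadForm H x v))

theorem maxwellian_eq (m β : ℝ) (v : Space d) : maxwellian m β v =
    (β * m / (2 * Real.pi)) ^ ((d : ℝ) / 2) * Real.exp (-(β * m / 2 * ‖v‖ ^ 2)) := by
  rw [maxwellian]; congr 3; ring

theorem hasTemperateGrowth_coord (r : Fin d) :
    (fun v : Space d => v r).HasTemperateGrowth := by
  have h := hasTemperateGrowth_inner (EuclideanSpace.single r (1 : ℝ))
  simpa only [EuclideanSpace.inner_single_right, conj_trivial, one_mul] using h

theorem hasTemperateGrowth_quadForm (H : Fin d → Fin d → Space d → ℝ) (x : Space d) :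
    (quadForm H x).HasTemperateGrowth :=
  Function.HasTemperateGrowth.sum fun r _ => Function.HasTemperateGrowth.sum fun s _ =>
    ((hasTemperateGrowth_coord r).mul (hasTemperateGrowth_coord s)).mul
      (Function.HasTemperateGrowth.const _)

variable {m β : ℝ}

theorem fourierInt_maxwellian (hm : 0 < m) (hβ : 0 < β) (η : Space d) :
    fourierInt (fun v => (maxwellian m β v : ℂ)) η =
      ((Real.exp (-((2 * (β * m))⁻¹ * ‖η‖ ^ 2)) : ℝ) : ℂ) := by
  have hb : 0 < β * m / 2 := by positivity
  simp only [maxwellian_eq, Complex.ofReal_mul]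
  rw [fourierInt_const_mul, fourierInt_gaussian hb, ← Complex.ofReal_mul, ← mul_assoc,
    ← Real.mul_rpow (by positivity) (by positivity)]
  have h1 : β * m / (2 * Real.pi) * (Real.pi / (β * m / 2)) = 1 := by
    have := Real.pi_ne_zero
    field_simp
  rw [h1, Real.one_rpow, one_mul]
  congr 3
  ring

/-- With `2b = βm`, the diagonal part of the second moments contributes `ΔV/m`, which cancels the
`-ΔV/m` in the equilibrium. Only the quadratic form in `η` survives. -/
theorem fourierInt_equilibrium (hbar : ℝ) (hm : 0 < m) (hβ : 0 < β)
    (H : Fin d → Fin d → Space d → ℝ) (x η : Space d) :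
    fourierInt (fun v => (equilibrium hbar m β H x v : ℂ)) η =
      fourierInt (fun v => (maxwellian m β v : ℂ)) η *
        (1 - ((β * hbar ^ 2 / (24 * m ^ 2) * quadForm H x η : ℝ) : ℂ)) := by
  set b := β * m / 2 with hbdef
  have hb : 0 < b := by positivity
  set N := (β * m / (2 * Real.pi)) ^ ((d : ℝ) / 2) with hN
  set γ : Space d → ℝ := fun v => Real.exp (-(b * ‖v‖ ^ 2)) with hγ
  set a0 := N * (1 - hbar ^ 2 * (β ^ 2 / 24) * (1 / m) * ∑ r, H r r x) with ha0
  set a1 := N * (hbar ^ 2 * (β ^ 2 / 24) * β) with ha1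
  set e : Fin d → Space d := fun r => EuclideanSpace.single r (1 : ℝ) with he
  have hve : ∀ (v : Space d) r, inner ℝ v (e r) = v r := fun v r => by
    simp only [he, EuclideanSpace.inner_single_right, conj_trivial, one_mul]
  have hee : ∀ r s, inner ℝ (e r) (e s) = if r = s then (1 : ℝ) else 0 := fun r s => by
    rw [hve]; simp [he, eq_comm]
  have iγ : Integrable fun v : Space d => (γ v : ℂ) := by
    have h := integrable_mul_gaussian (Function.HasTemperateGrowth.const (1 : ℝ)) hb (d := d)
    simp only [one_mul] at h
    exact h.ofReal
  have i2 : ∀ r s, Integrable fun v : Space d =>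
      ((inner ℝ v (e r) * inner ℝ v (e s) * γ v : ℝ) : ℂ) := fun r s =>
    (integrable_mul_gaussian ((hasTemperateGrowth_inner (e r)).mul
      (hasTemperateGrowth_inner (e s))) hb).ofReal
  have hQ : (fun v => (equilibrium hbar m β H x v : ℂ)) = fun v => (a0 : ℂ) * (γ v : ℂ) +
      (a1 : ℂ) * ∑ r, ∑ s, (H r s x : ℂ) *
        ((inner ℝ v (e r) * inner ℝ v (e s) * γ v : ℝ) : ℂ) := by
    funext v
    rw [equilibrium, maxwellian_eq, ← hN, quadForm]
    simp only [hve]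
    norm_cast
    have : ∑ r, ∑ s, H r s x * (v r * v s * γ v) = (∑ r, ∑ s, v r * v s * H r s x) * γ v := by
      simp only [Finset.sum_mul]
      refine Finset.sum_congr rfl fun r _ => Finset.sum_congr rfl fun s _ => by ring
    rw [this, ha0, ha1]
    simp only [hγ]
    ring
  have hF : (fun v : Space d => (maxwellian m β v : ℂ)) = fun v => (N : ℂ) * (γ v : ℂ) := by
    funext v
    rw [maxwellian_eq, Complex.ofReal_mul]
  rw [hQ, hF, fourierInt_const_mul, fourierInt_add (iγ.const_mul _)
    ((integrable_finsetSum _ fun r _ => integrable_finsetSum _ fun s _ =>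
      (i2 r s).const_mul _).const_mul _), fourierInt_const_mul, fourierInt_const_mul,
    fourierInt_sum _ fun r _ => integrable_finsetSum _ fun s _ => (i2 r s).const_mul _]
  have hsum : ∀ r, fourierInt (fun v => ∑ s, (H r s x : ℂ) *
      ((inner ℝ v (e r) * inner ℝ v (e s) * γ v : ℝ) : ℂ)) η =
      ((∑ s, H r s x * ((if r = s then 1 else 0) / (2 * b) - η r * η s / (4 * b ^ 2)) : ℝ) : ℂ) *
        fourierInt (fun v => (γ v : ℂ)) η := fun r => by
    rw [fourierInt_sum _ fun s _ => (i2 r s).const_mul _, Complex.ofReal_sum, Finset.sum_mul]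
    refine Finset.sum_congr rfl fun s _ => ?_
    rw [fourierInt_const_mul, fourierInt_second_moment hb, hee, hve, hve, Complex.ofReal_mul,
      mul_assoc]
  simp only [hsum]
  rw [← Finset.sum_mul, ← Complex.ofReal_sum]
  have hval : ∑ r, ∑ s, H r s x * ((if r = s then 1 else 0) / (2 * b) - η r * η s / (4 * b ^ 2)) =
      (∑ r, H r r x) / (2 * b) - quadForm H x η / (4 * b ^ 2) := by
    rw [quadForm, Finset.sum_div, Finset.sum_div, ← Finset.sum_sub_distrib]
    refine Finset.sum_congr rfl fun r _ => ?_
    have : H r r x / (2 * b) = ∑ s, H r s x * ((if r = s then 1 else 0) / (2 * b)) := by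
      simp [div_eq_mul_inv]
    rw [this, Finset.sum_div, ← Finset.sum_sub_distrib]
    refine Finset.sum_congr rfl fun s _ => by ring
  rw [hval]
  have key : a0 + a1 * ((∑ r, H r r x) / (2 * b) - quadForm H x η / (4 * b ^ 2)) =
      N * (1 - β * hbar ^ 2 / (24 * m ^ 2) * quadForm H x η) := by
    rw [ha0, ha1, hbdef]; field_simp; ring
  have keyc := congrArg (fun t : ℝ => (t : ℂ)) key
  push_cast at keyc ⊢
  linear_combination (fourierInt (fun v => (γ v : ℂ)) η) * keyc

theorem memLp_equilibrium (k : ℕ) (hbar : ℝ) (hm : 0 < m) (hβ : 0 < β)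
    (H : Fin d → Fin d → Space d → ℝ) (x : Space d) :
    MemLp (equilibrium hbar m β H x) 2 (weightedMeasure d k) := by
  have hq := hasTemperateGrowth_quadForm H x
  have hb : 0 < β * m := by positivity
  have hp : (fun v : Space d => 1 + hbar ^ 2 * (β ^ 2 / 24) *
      (-(1 / m) * ∑ r, H r r x + β * quadForm H x v)).HasTemperateGrowth := by fun_prop
  have hw : (fun v : Space d => 1 + (‖v‖ ^ 2) ^ k).HasTemperateGrowth := by fun_prop
  have hc : Continuous (equilibrium hbar m β H x) := by
    have h1 : Continuous (maxwellian m β : Space d → ℝ) := by unfold maxwellian; fun_prop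
    exact h1.mul hp.1.continuous
  rw [memLp_two_iff_integrable_sq (aestronglyMeasurable_weightedMeasure.2 hc.aestronglyMeasurable),
    integrable_weightedMeasure]
  refine ((integrable_mul_gaussian (hw.mul (hp.mul hp)) hb).const_mul
    (((β * m / (2 * Real.pi)) ^ ((d : ℝ) / 2)) ^ 2)).congr (Eventually.of_forall fun v => ?_)
  have hexp : Real.exp (-(β * m * ‖v‖ ^ 2)) = Real.exp (-(β * m / 2 * ‖v‖ ^ 2)) ^ 2 := by
    rw [← Real.exp_nat_mul]; congr 1; push_cast; ring
  simp only [Pi.mul_apply, equilibrium, maxwellian_eq, hexp, pow_mul]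
  ring

theorem integrable_fourierV_equilibrium (hbar : ℝ) (hm : 0 < m) (hβ : 0 < β)
    (H : Fin d → Fin d → Space d → ℝ) (x : Space d) :
    Integrable (fourierV fun v => (equilibrium hbar m β H x v : ℂ)) := by
  have hq := hasTemperateGrowth_quadForm H x
  have hp : (fun η : Space d => 1 - β * hbar ^ 2 / (24 * m ^ 2) *
      quadForm H x η).HasTemperateGrowth := by fun_prop
  have hb : 0 < (2 * (β * m))⁻¹ := by positivity
  refine ((integrable_mul_gaussian hp hb).ofReal.const_mul
    (((2 * Real.pi) ^ (-(d : ℝ) / 2) : ℝ) : ℂ)).congr (Eventually.of_forall fun η => ?_)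
  rw [fourierV_eq, fourierInt_equilibrium hbar hm hβ, fourierInt_maxwellian hm hβ,
    ← Complex.ofReal_one, ← Complex.ofReal_sub, ← Complex.ofReal_mul, mul_comm (Real.exp _)]
  rfl

/-- The integral is the Fourier integral at `η = 0`, where the quantum correction vanishes. -/
theorem integral_equilibrium (hbar : ℝ) (hm : 0 < m) (hβ : 0 < β)
    (H : Fin d → Fin d → Space d → ℝ) (x : Space d) :
    ∫ v, equilibrium hbar m β H x v = 1 := by
  have h := fourierInt_equilibrium hbar hm hβ H x 0
  rw [fourierInt_maxwellian hm hβ, fourierInt_zero, integral_complex_ofReal] at h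
  have h2 : quadForm H x 0 = 0 := by simp [quadForm]
  rw [h2] at h
  simp only [norm_zero, ne_eq, OfNat.ofNat_ne_zero, not_false_eq_true, zero_pow, mul_zero,
    neg_zero, Real.exp_zero, Complex.ofReal_one, Complex.ofReal_zero, sub_zero, mul_one] at h
  exact_mod_cast h

end Equilibrium

/-! ### Kernel and range -/

section Main

variable {d k : ℕ}

/-- The integral with respect to Lebesgue measure as a linear functional on `Xkv d k`. -/
def intX (hk : d < 2 * k) : Xkv d k →ₗ[ℝ] ℝ where
  toFun w := ∫ v : Space d, w v
  map_add' w z := by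
    rw [← integral_add (w.integrable hk) (z.integrable hk)]
    exact integral_congr_ae (Xkv.coeFn_add w z)
  map_smul' c w := by
    rw [RingHom.id_apply, smul_eq_mul, ← integral_const_mul]
    exact integral_congr_ae (Xkv.coeFn_smul c w)

theorem intX_apply (hk : d < 2 * k) (w : Xkv d k) : intX hk w = ∫ v : Space d, w v := rfl

theorem intX_convOp (hk : d < 2 * k) {K : Space d → ℝ} (hK : MemLp K 2 (weightedMeasure d k))
    (hodd : ∀ t, K (-t) = -K t) (w : Xkv d k) : intX hk (convOp hk hK w) = 0 := by
  have hK' := memLp_weightedMeasure.1 hK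
  have hK1 := (integrable_of_memLp_weight hk hK'.1 hK'.2 le_rfl).1
  have h0 : ∫ t, K t = 0 := by
    have h := integral_neg_eq_self K (volume : Measure (Space d))
    simp only [hodd, integral_neg] at h
    linarith
  rw [intX_apply, integral_congr_ae (convOp_coeFn hk hK w),
    integral_convolution (mul ℝ ℝ) hK1 (w.integrable hk), h0, map_zero, zero_apply]

/-- The kernel and the range of a rank-one perturbation of an invertible operator that multiplies
a functional by a constant. -/
theorem ker_range_rankOne_sub {X : Type*} [AddCommGroup X] [Module ℝ X] {S : X →ₗ[ℝ] X}
    (hS : Function.Bijective S) {I : X →ₗ[ℝ] ℝ} {ν : ℝ} (hν : ν ≠ 0)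
    (hI : ∀ w, I (S w) = ν * I w) {Q M : X} (hQ : I Q = 1) (hM : S M = ν • Q) :
    LinearMap.ker ((ν • I).smulRight Q - S) = Submodule.span ℝ {M} ∧
    Module.finrank ℝ (LinearMap.ker ((ν • I).smulRight Q - S)) = 1 ∧
    ∀ h, (∃ w, ((ν • I).smulRight Q - S) w = h) ↔ I h = 0 := by
  have hIM : I M = 1 := by
    have := hI M
    rw [hM, map_smul, hQ, smul_eq_mul, mul_one] at this
    exact (mul_right_eq_self₀.1 this.symm).resolve_right hν
  have hT : ∀ w, ((ν • I).smulRight Q - S) w = (ν * I w) • Q - S w := fun w => rfl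
  have hker : LinearMap.ker ((ν • I).smulRight Q - S) = Submodule.span ℝ {M} := by
    ext w
    rw [LinearMap.mem_ker, hT, sub_eq_zero, Submodule.mem_span_singleton]
    constructor
    · intro h
      refine ⟨I w, hS.1 ?_⟩
      rw [map_smul, hM, smul_smul, mul_comm, h]
    · rintro ⟨c, rfl⟩
      rw [map_smul, map_smul, hIM, hM, smul_smul, smul_eq_mul, mul_one, mul_comm]
  refine ⟨hker, ?_, fun h => ⟨?_, fun hh => ?_⟩⟩
  · rw [hker, finrank_span_singleton]
    rintro rfl
    simp at hIM
  · rintro ⟨w, rfl⟩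
    rw [hT, map_sub, map_smul, hQ, hI, smul_eq_mul, mul_one, sub_self]
  · obtain ⟨w, hw⟩ := hS.2 h
    have hIw : I w = 0 := by
      have := hI w
      rw [hw, hh] at this
      exact (mul_eq_zero.1 this.symm).resolve_left hν
    refine ⟨-w, ?_⟩
    rw [hT, map_neg, map_neg, hIw, hw, neg_zero, mul_zero, zero_smul, zero_sub, neg_neg]

theorem Omega_eq (hbar m β ν : ℝ) (H : Fin d → Fin d → Space d → ℝ) (x : Space d)
    (w : Space d → ℝ) (v : Space d) :
    Omega hbar m β ν H x w v = ν * (∫ v', w v') * equilibrium hbar m β H x v := by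
  rw [Omega, equilibrium, quadForm]; ring

theorem ae_eq_kernelM {hbar m β ν : ℝ} (hm : 0 < m) (hβ : 0 < β) (hν : 0 < ν)
    {V : Space d → ℝ} {H : Fin d → Fin d → Space d → ℝ} {x : Space d} {K M : Space d → ℝ}
    (hδ : ∀ᵐ η : Space d, Complex.I * (deltaV hbar m V x η : ℂ) =
      fourierInt (fun v => (K v : ℂ)) η) (hK : Integrable K) (hK2 : MemLp K 2 volume)
    (hQ : Integrable (equilibrium hbar m β H x))
    (hM : Integrable M) (hM2 : MemLp M 2 volume)
    (hMeq : ∀ᵐ v, ν * M v = (K ⋆[mul ℝ ℝ] M) v + ν * equilibrium hbar m β H x v) :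
    ∀ᵐ v, (M v : ℂ) = kernelM hbar m β ν V H x v := by
  have hνc : (ν : ℂ) ≠ 0 := by exact_mod_cast hν.ne'
  have hKM : Integrable (K ⋆[mul ℝ ℝ] M) := hK.integrable_convolution (mul ℝ ℝ) hM
  have hInt : ∀ η, (ν : ℂ) * fourierInt (fun v => (M v : ℂ)) η =
      fourierInt (fun v => ((K ⋆[mul ℝ ℝ] M) v : ℂ)) η +
      ν * fourierInt (fun v => (equilibrium hbar m β H x v : ℂ)) η := fun η => by
    have hQc : Integrable fun v => (equilibrium hbar m β H x v : ℂ) := hQ.ofReal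
    rw [← fourierInt_const_mul, ← fourierInt_const_mul,
      ← fourierInt_add (f := fun v => ((K ⋆[mul ℝ ℝ] M) v : ℂ)) hKM.ofReal
        (hQc.const_mul (ν : ℂ))]
    refine fourierInt_congr_ae ?_ η
    filter_upwards [hMeq] with v hv
    exact_mod_cast hv
  -- The equation expresses the transform of `M` through those of `K ⋆ M` and of the equilibrium,
  -- both integrable; inversion is therefore available for `M`.
  have hFM : Integrable (fourierV fun v => (M v : ℂ)) := by
    refine (((integrable_fourierV_conv hK hK2 hM hM2).const_mul (ν : ℂ)⁻¹).add
      (integrable_fourierV_equilibrium hbar hm hβ H x)).congr (Eventually.of_forall fun η => ?_)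
    simp only [Pi.add_apply, fourierV_eq]
    generalize (((2 * Real.pi) ^ (-(d : ℝ) / 2) : ℝ) : ℂ) = c
    field_simp
    linear_combination -c * hInt η
  have hkM : kernelM hbar m β ν V H x = fourierVInv (fourierV fun v => (M v : ℂ)) := by
    funext v
    rw [kernelM, ← fourierVInv_const_mul]
    refine congrFun (fourierVInv_congr_ae ?_) v
    filter_upwards [hδ] with η hη
    -- `δV` is real, so the divisor has real part `ν > 0`.
    have hne : (ν : ℂ) - Complex.I * (deltaV hbar m V x η : ℂ) ≠ 0 := fun h => by
      have := congrArg Complex.re h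
      simp at this
      exact hν.ne' this
    have h1 := hInt η
    rw [fourierInt_conv hK hM, ← hη, fourierInt_equilibrium hbar hm hβ, quadForm] at h1
    rw [fourierV_eq, fourierV_eq]
    generalize (((2 * Real.pi) ^ (-(d : ℝ) / 2) : ℝ) : ℂ) = c
    rw [div_mul_eq_mul_div, mul_div_assoc', div_eq_iff hne]
    linear_combination -c * h1
  rw [hkM]
  filter_upwards [fourierVInv_fourierV_ae hM.ofReal hFM] with v hv
  exact hv.symm

end Main

end WignerBGK

end

/-! ### The main theorem -/

theorem mainTheorem2 (d k : ℕ) (hk : d < 2 * k)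
    (hbar m β ν : ℝ) (hhbar : 0 < hbar) (hm : 0 < m) (hβ : 0 < β) (hν : 0 < ν)
    (V : WignerBGK.Space d → ℝ) (hV : WignerBGK.MemH (max 2 k) V)
    (H : Fin d → Fin d → WignerBGK.Space d → ℝ) (hH : WignerBGK.IsWeakHessian V H)
    (x : WignerBGK.Space d) :
    ∃ (T : WignerBGK.Xkv d k →ₗ[ℝ] WignerBGK.Xkv d k) (M : WignerBGK.Xkv d k),
      (∀ w : WignerBGK.Xkv d k,
        ∀ᵐ v : WignerBGK.Space d, ((T w v : ℝ) : ℂ) = WignerBGK.opAC hbar m β ν V H x w v) ∧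
      (∀ᵐ v : WignerBGK.Space d, ((M v : ℝ) : ℂ) = WignerBGK.kernelM hbar m β ν V H x v) ∧
      LinearMap.ker T = Submodule.span ℝ {M} ∧
      Module.finrank ℝ (LinearMap.ker T) = 1 ∧
      ∀ h : WignerBGK.Xkv d k,
        (∃ w : WignerBGK.Xkv d k, T w = h) ↔ ∫ v : WignerBGK.Space d, h v = 0 := by
  open WignerBGK in
  obtain ⟨K, hK, hodd, hδ⟩ := hV.exists_kernel (le_max_right 2 k) hk hhbar hm x
  have hK' := memLp_weightedMeasure.1 hK
  have hK1 := (integrable_of_memLp_weight hk hK'.1 hK'.2 le_rfl).1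
  have hQm := memLp_equilibrium k hbar hm hβ H x
  have hQae := Xkv.coeFn_toLp hQm
  set Q : Xkv d k := hQm.toLp
  set S : Xkv d k →L[ℝ] Xkv d k := ν • ContinuousLinearMap.id ℝ (Xkv d k) - convOp hk hK with hSdef
  have hSb : Function.Bijective (S : Xkv d k →ₗ[ℝ] Xkv d k) := bijective_sub_convOp hk hK hodd hν
  have hSae : ∀ w : Xkv d k, ∀ᵐ v : Space d, S w v =
      ν * w v - (MeasureTheory.convolution K w (ContinuousLinearMap.mul ℝ ℝ) volume) v := by
    intro w
    filter_upwards [convOp_coeFn hk hK w, Xkv.coeFn_sub (ν • w) (convOp hk hK w),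
      Xkv.coeFn_smul ν w] with v h1 h2 h3
    rw [← h1, ← h3, ← h2]; rfl
  obtain ⟨M, hM⟩ := hSb.2 (ν • Q)
  have hIS : ∀ w, intX hk (S w) = ν * intX hk w := fun w => by
    have : S w = ν • w - convOp hk hK w := rfl
    rw [this, map_sub, map_smul, intX_convOp hk hK hodd, sub_zero, smul_eq_mul]
  have hIQ : intX hk Q = 1 := by
    rw [intX_apply, integral_congr_ae hQae, integral_equilibrium hbar hm hβ]
  obtain ⟨h1, h2, h3⟩ := ker_range_rankOne_sub hSb hν.ne' hIS hIQ hM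
  -- `Ωw = ν (∫ w) Q`, while `S` gathers `ν w` and `-Θ[V]w`; hence this operator represents `𝒜 + 𝒞`.
  refine ⟨(ν • intX hk).smulRight Q - S, M, fun w => ?_, ?_, h1, h2, h3⟩
  · have hT : ((ν • intX hk).smulRight Q - (S : Xkv d k →ₗ[ℝ] Xkv d k)) w =
        (ν * ∫ v, w v) • Q - S w := rfl
    rw [hT]
    filter_upwards [Theta_ae_eq_conv hδ hK1 hK'.1 (w.integrable hk) w.memLp_two, hSae w, hQae,
      Xkv.coeFn_sub ((ν * ∫ v, w v) • Q) (S w), Xkv.coeFn_smul (ν * ∫ v, w v) Q]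
      with v e1 e2 e3 e4 e5
    rw [opAC, e1, e4, e5, e2, e3, Omega_eq]
    push_cast
    ring
  · have hQ1 : MeasureTheory.Integrable (equilibrium hbar m β H x) :=
      (Q.integrable hk).congr hQae
    refine ae_eq_kernelM hm hβ hν hδ hK1 hK'.1 hQ1 (M.integrable hk) M.memLp_two ?_
    have hM' : S M = ν • Q := hM
    have e1 := hSae M
    rw [hM'] at e1
    filter_upwards [e1, Xkv.coeFn_smul ν Q, hQae] with v e1 e2 e3
    rw [e2, e3] at e1
    linarith
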